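/- Theorem. For $g\in L^2(\mathbb{R}^d)$ with $\|g\|_2=1$ and $f\in L^2(\mathbb{R}^d)$ let $$V_gf(x,\xi)=\int_{\mathbb{R}^d} f(t)\,\overline{g(t-x)}\,e^{-2\pi i\xi\cdot t}\,dt,\qquad (x,\xi)\in\mathbb{R}^{d}\times\mathbb{R}^d=\mathbb{R}^{2d},$$ be the short-time Fourier transform, and let $\|g\|_{M^*}^2:=\int_{\mathbb{R}^{2d}}|z|\,|V_gg(z)|^2\,dz$; write $g\in M^*(\mathbb{R}^d)$ if this is finite. For a compact set $\Omega\subset\mathbb{R}^{2d}$ let $$H_\Omega f(t)=\int_\Omega V_gf(x,\xi)\,g(t-x)\,e^{2\pi i\xi\cdot t}\,dx\,d\xi$$ be the time-frequency localization operator on $L^2(\mathbb{R}^d)$, and let $|\partial\Omega|$ be the perimeter of $\Omega$, that is, the variation $$|\partial\Omega|=\sup\Big\{\int_\Omega \operatorname{div}\phi(z)\,dz:\ \phi\in C^1_c(\mathbb{R}^{2d},\mathbb{R}^{2d}),\ |\phi|\le 1\Big\}$$ of its characteristic function. Let $A_\Omega=\lceil|\Omega|\rceil$. An eigensystem of $H_\Omega$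 is a listing, finite or infinite, of its nonzero eigenvalues $\lambda_1\ge\lambda_2\ge\dots$, repeated according to multiplicity, together with a corresponding orthonormal system of eigenfunctions $h_1,h_2,\dots$ (so that no nonzero eigenfunction with a nonzero eigenvalue is orthogonal to all $h_k$). There is an absolute constant $C$ such that the following holds for every $d$, every $g\in M^*(\mathbb{R}^d)$ with $\|g\|_2=1$ and every compact set $\Omega\subset\mathbb{R}^{2d}$ of finite perimeter with $\|g\|_{M^*}^2\,|\partial\Omega|\ge 1$. An eigensystem of $H_\Omega$ exists. Every eigensystem of $H_\Omega$ has at least $A_\Omega$ members, and if $\rho_\Omega(z)=\sum_{k=1}^{A_\Omega}|V_gh_k(z)|^2$ is the accumulated spectrogram that it defines, then the level set $\widetilde\Omega=\{z\in\mathbb{R}^{2d}:\rho_\Omega(z)>1/2\}$ satisfies $$|\Omega\,\triangle\,\widetilde\Omega|\ \le\ C\,\|g\|_{M^*}^2\,|\partial\Omega|.$$ -/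

import Mathlib

open MeasureTheory
open scoped ENNReal NNReal ComplexConjugate symmDiff

/-- Divergence of a vector field: the trace of its derivative. -/
noncomputable def divergence {F : Type*} [NormedAddCommGroup F] [NormedSpace ℝ F]
    (φ : F → F) (x : F) : ℝ :=
  LinearMap.trace ℝ F (fderiv ℝ φ x : F →ₗ[ℝ] F)

/-- Total variation of `f`: the supremum of `∫ f div φ` over compactly supported `C¹` vector
fields `φ` with `|φ| ≤ 1`. (The field `φ = 0` is admissible, so the supremum is nonnegative.) -/
noncomputable def variation {F : Type*} [NormedAddCommGroup F] [InnerProductSpace ℝ F]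
    [FiniteDimensional ℝ F] [MeasurableSpace F] [BorelSpace F] (f : F → ℝ) : ℝ≥0∞ :=
  ⨆ (φ : F → F) (_ : ContDiff ℝ 1 φ ∧ HasCompactSupport φ ∧ ∀ x, ‖φ x‖ ≤ 1),
    ENNReal.ofReal (∫ x, f x * divergence φ x)

/-- Functions of bounded variation on a Euclidean space. -/
def IsBV {F : Type*} [NormedAddCommGroup F] [InnerProductSpace ℝ F]
    [FiniteDimensional ℝ F] [MeasurableSpace F] [BorelSpace F] (f : F → ℝ) : Prop :=
  Integrable f ∧ variation f < ∞

/-- The perimeter `|∂S|` of a set: the variation of its characteristic function. -/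
noncomputable def perimeter {F : Type*} [NormedAddCommGroup F] [InnerProductSpace ℝ F]
    [FiniteDimensional ℝ F] [MeasurableSpace F] [BorelSpace F] (S : Set F) : ℝ≥0∞ :=
  variation (S.indicator (fun _ => (1 : ℝ)))

/-- A set has finite perimeter if its characteristic function has bounded variation. -/
def HasFinitePerimeter {F : Type*} [NormedAddCommGroup F] [InnerProductSpace ℝ F]
    [FiniteDimensional ℝ F] [MeasurableSpace F] [BorelSpace F] (S : Set F) : Prop :=
  IsBV (S.indicator (fun _ => (1 : ℝ)))

/-- `L²(ℝᵈ)`, complex valued. -/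
abbrev L2Space (d : ℕ) : Type :=
  Lp ℂ 2 (volume : Measure (EuclideanSpace ℝ (Fin d)))

/-- `ℝ²ᵈ`, the points `z = (x, ξ)` with Euclidean norm `(|x|² + |ξ|²)^(1/2)`. -/
abbrev PhaseSpace (d : ℕ) : Type :=
  WithLp 2 (EuclideanSpace ℝ (Fin d) × EuclideanSpace ℝ (Fin d))

/-- Short-time Fourier transform
`V_g f (x, ξ) = ∫ f(t) conj(g(t - x)) exp(-2πi ξ·t) dt`. -/
noncomputable def stft {d : ℕ} (g f : L2Space d) (z : PhaseSpace d) : ℂ :=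
  ∫ t, f t * conj (g (t - z.fst)) *
    Complex.exp (-(2 * Real.pi * Complex.I * (inner ℝ z.snd t : ℝ)))

/-- The spectrogram `|V_g f|²`. -/
noncomputable def spectrogram {d : ℕ} (g f : L2Space d) (z : PhaseSpace d) : ℝ :=
  ‖stft g f z‖ ^ 2

/-- `‖g‖²_{M*} = ∫ |z| |V_g g(z)|² dz`, with values in `[0, ∞]`. -/
noncomputable def mStarNormSq {d : ℕ} (g : L2Space d) : ℝ≥0∞ :=
  ∫⁻ z : PhaseSpace d, ENNReal.ofReal (‖z‖ * spectrogram g g z)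

/-- The class `M*(ℝᵈ)`. -/
def MemMStar {d : ℕ} (g : L2Space d) : Prop := mStarNormSq g < ∞

/-- The time-frequency localization operator
`H_Ω f (t) = ∫_Ω V_g f(x, ξ) g(t - x) exp(2πi ξ·t) dx dξ`. -/
noncomputable def locOp {d : ℕ} (g : L2Space d) (Ω : Set (PhaseSpace d)) (f : L2Space d)
    (t : EuclideanSpace ℝ (Fin d)) : ℂ :=
  ∫ z in Ω, stft g f z * g (t - z.fst) *
    Complex.exp (2 * Real.pi * Complex.I * (inner ℝ z.snd t : ℝ))

/-- The equation `H_Ω f = μ f` in `L²(ℝᵈ)`. -/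
def LocOpEigen {d : ℕ} (g : L2Space d) (Ω : Set (PhaseSpace d)) (μ : ℂ) (f : L2Space d) :
    Prop :=
  ∀ᵐ t, locOp g Ω f t = μ * f t

/-- `(lam k)` and `(h k)`, for `k < N` with `N ≤ ∞`, are the nonzero eigenvalues of `H_Ω`, repeated
according to multiplicity and ordered non-increasingly, and a corresponding orthonormal system of
eigenfunctions. Indices start at `0`; the values at indices `k ≥ N` play no role. -/
structure IsEigensystem {d : ℕ} (g : L2Space d) (Ω : Set (PhaseSpace d)) (N : ℕ∞)
    (lam : ℕ → ℝ) (h : ℕ → L2Space d) : Prop where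
  orthonormal : Orthonormal ℂ (fun k : {k : ℕ // (k : ℕ∞) < N} => h k)
  eigen : ∀ k : ℕ, (k : ℕ∞) < N → LocOpEigen g Ω (lam k) (h k)
  ne_zero : ∀ k : ℕ, (k : ℕ∞) < N → lam k ≠ 0
  ordered : ∀ j k : ℕ, j ≤ k → (k : ℕ∞) < N → lam k ≤ lam j
  /-- Nothing is left out: an eigenfunction for a nonzero eigenvalue cannot be orthogonal
  to all the `h k`. -/
  complete : ∀ (μ : ℂ) (f : L2Space d), μ ≠ 0 → LocOpEigen g Ω μ f →
    (∀ k : ℕ, (k : ℕ∞) < N → inner ℂ (h k) f = 0) → f = 0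

/-- `A_Ω = ⌈|Ω|⌉`. -/
noncomputable def ceilVolume {d : ℕ} (Ω : Set (PhaseSpace d)) : ℕ :=
  ⌈(volume Ω).toReal⌉₊

/-- The accumulated spectrogram `ρ_Ω`, the sum of the first `A_Ω` spectrograms. -/
noncomputable def accumulatedSpectrogram {d : ℕ} (g : L2Space d) (Ω : Set (PhaseSpace d))
    (h : ℕ → L2Space d) (z : PhaseSpace d) : ℝ :=
  ∑ k ∈ Finset.range (ceilVolume Ω), spectrogram g (h k) z

/-- The level set `{ρ_Ω > 1/2}`. -/
def recoveredDomain {d : ℕ} (g : L2Space d) (Ω : Set (PhaseSpace d))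
    (h : ℕ → L2Space d) : Set (PhaseSpace d) :=
  {z | 1 / 2 < accumulatedSpectrogram g Ω h z}

/-! ### Spectral systems of positive symmetric operators of finite trace. -/

section SpectralSystem

variable {H : Type*} [NormedAddCommGroup H] [InnerProductSpace ℂ H]

/-! Let `π(z)g` be the time-frequency shift of `g`, so that `V_g f(z) = ⟨π(z)g, f⟩` and `H_Ω` is the
integral over `Ω` of the projections onto `π(z)g`: a positive compact operator. Put `K(w,z) =
|⟨π(w)g, π(z)g⟩|²`. This equals `|V_g g(w - z)|²` (`norm_inner_tfShift`), and Moyal's formula gives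
it mass 1 in `w`. Write `s_k = |V_g h_k|²`, also of mass 1, and `P = ‖g‖²_{M*} |∂Ω|`.

Expanding `⟨π(z)g, H_Ω π(z)g⟩` in eigenfunctions gives the pointwise identity `∑ λ_k s_k(z) = ∫_Ω
K(w,z) dw` (`IsSpectralSystem.tsum_mul_enorm_stft_sq`). Its integral over phase space is `∑ λ_k =
|Ω|`. Its integral over the complement of `Ω` is `∑ λ_k (1 - λ_k) = ∫_{Ωᶜ} ∫_Ω K`, because `λ_k` is
the mass of `s_k` in `Ω`. The last quantity is at most `P`: translating `1_Ω` by `u` changes it by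
at most `|u| |∂Ω|` in `L¹`, and this is integrated against `|V_g g(u)|²`.

Eigenvalues in `[0,1]` with sum `|Ω|` and small `∑ λ_k (1 - λ_k)` are nearly 1 for `k < A_Ω` and
nearly 0 afterwards: `∑_{k<A} (1 - λ_k) + ∑_{k≥A} λ_k ≤ 1 + 2P` (`sum_one_sub_add_tail_le`). So
`ρ_Ω` differs from `1_Ω` by the defect and tail sums weighted by the `s_k`, plus the mass of `K`
that crosses the boundary of `Ω`. The sum of these errors, `recoveryError`, is at least 1/2 on `Ω ∆
Ω̃` and has integral at most `1 + 4P`. Chebyshev's inequality finishes the proof, and `P ≥ 1`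
absorbs the constant. -/

/-- A complete orthonormal listing of the eigenvectors of `T` with nonzero eigenvalues, the
eigenvalues being ordered non-increasingly. -/
structure IsSpectralSystem (T : H →L[ℂ] H) (N : ℕ∞) (lam : ℕ → ℝ) (h : ℕ → H) : Prop where
  orthonormal : Orthonormal ℂ (fun k : {k : ℕ // (k : ℕ∞) < N} => h k)
  eigen : ∀ k : ℕ, (k : ℕ∞) < N → T (h k) = (lam k : ℂ) • h k
  ne_zero : ∀ k : ℕ, (k : ℕ∞) < N → lam k ≠ 0
  ordered : ∀ j k : ℕ, j ≤ k → (k : ℕ∞) < N → lam k ≤ lam j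
  complete : ∀ (μ : ℂ) (f : H), μ ≠ 0 → T f = μ • f →
    (∀ k : ℕ, (k : ℕ∞) < N → inner ℂ (h k) f = 0) → f = 0

theorem inner_map_self_of_eigen {T : H →L[ℂ] H} {μ : ℂ} {f : H} (hf : T f = μ • f) :
    inner ℂ f (T f) = μ * (‖f‖ : ℂ) ^ 2 := by
  rw [hf, inner_smul_right, inner_self_eq_norm_sq_to_K]; rfl

theorem exists_pos_eq_of_eigen {T : H →L[ℂ] H} (hT : (T : H →ₗ[ℂ] H).IsSymmetric)
    (hpos : ∀ x, 0 ≤ (inner ℂ x (T x)).re) {μ : ℂ} {f : H} (hμ : μ ≠ 0) (hf : f ≠ 0)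
    (h : T f = μ • f) : ∃ r : ℝ, 0 < r ∧ μ = r := by
  have h1 := inner_map_self_of_eigen h
  have h2 : (inner ℂ f (T f)).im = 0 := by
    have h3 : inner ℂ (T f) f = inner ℂ f (T f) := hT f f
    rw [← inner_conj_symm] at h3
    exact Complex.conj_eq_iff_im.1 h3
  have hn : 0 < ‖f‖ ^ 2 := by positivity
  have him : μ.im = 0 := by
    rw [h1, ← Complex.ofReal_pow, Complex.im_mul_ofReal] at h2
    exact (mul_eq_zero.1 h2).resolve_right hn.ne'
  have hre : 0 ≤ μ.re := by
    have := hpos f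
    rw [h1, ← Complex.ofReal_pow, Complex.re_mul_ofReal] at this
    exact nonneg_of_mul_nonneg_left this hn
  have hμe : μ = (μ.re : ℂ) := Complex.ext rfl (by simp [him])
  refine ⟨μ.re, lt_of_le_of_ne hre fun h0 => hμ ?_, hμe⟩
  rw [hμe, ← h0, Complex.ofReal_zero]

theorem inner_eq_zero_of_eigen {T : H →L[ℂ] H} (hT : (T : H →ₗ[ℂ] H).IsSymmetric) {a b : ℝ}
    {f u : H} (hab : a ≠ b) (hf : T f = (a : ℂ) • f) (hu : T u = (b : ℂ) • u) :
    inner ℂ f u = 0 := by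
  have h : inner ℂ (T f) u = inner ℂ f (T u) := hT f u
  rw [hf, hu, inner_smul_left, inner_smul_right, Complex.conj_ofReal] at h
  by_contra h0
  exact hab (by exact_mod_cast mul_right_cancel₀ h0 h)

/-- The eigenvalues of `T` that have an eigenvector orthogonal to `s`. -/
def orthEigenvalues (T : H →L[ℂ] H) (s : Set H) : Set ℝ :=
  {r | 0 < r ∧ ∃ f, ‖f‖ = 1 ∧ T f = (r : ℂ) • f ∧ ∀ x ∈ s, inner ℂ x f = 0}

theorem orthEigenvalues_antitone (T : H →L[ℂ] H) {s t : Set H} (hst : s ⊆ t) :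
    orthEigenvalues T t ⊆ orthEigenvalues T s := by
  rintro r ⟨hr, f, h1, h2, h3⟩
  exact ⟨hr, f, h1, h2, fun x hx => h3 x (hst hx)⟩

/-- Only finitely many eigenvalues can lie above a given `r₀ > 0`: eigenvectors for distinct
eigenvalues are orthogonal, so `n` of them would force `n r₀ ≤ B`. The hypothesis `hB` is a trace
bound phrased without traces, and it replaces compactness here. -/
theorem exists_max_orthEigenvalues {T : H →L[ℂ] H} (hT : (T : H →ₗ[ℂ] H).IsSymmetric) {B : ℝ}
    (hB : ∀ (e : ℕ → H) (n : ℕ), Orthonormal ℂ (fun i : Fin n => e i) →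
      ∑ i ∈ Finset.range n, (inner ℂ (e i) (T (e i))).re ≤ B)
    {s : Set H} (hs : (orthEigenvalues T s).Nonempty) :
    ∃ r ∈ orthEigenvalues T s, ∀ r' ∈ orthEigenvalues T s, r' ≤ r := by
  obtain ⟨r₀, hr₀⟩ := hs
  have hfin : (orthEigenvalues T s ∩ Set.Ici r₀).Finite := by
    by_contra hinf
    let em := Set.Infinite.natEmbedding _ hinf
    have hem : ∀ i, ∃ f, ‖f‖ = 1 ∧ T f = (((em i : ℝ)) : ℂ) • f := fun i => by
      obtain ⟨-, f, h1, h2, -⟩ := (em i).2.1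
      exact ⟨f, h1, h2⟩
    choose e he1 he2 using hem
    have hor : Orthonormal ℂ e := by
      refine ⟨he1, fun i j hij => ?_⟩
      refine inner_eq_zero_of_eigen hT (fun h => hij (em.injective (Subtype.ext h))) (he2 i) (he2 j)
    obtain ⟨n, hn⟩ := exists_nat_gt (B / r₀)
    have h1 := hB e n (hor.comp _ Fin.val_injective)
    have h2 : ∑ i ∈ Finset.range n, r₀ ≤
        ∑ i ∈ Finset.range n, (inner ℂ (e i) (T (e i))).re := by
      refine Finset.sum_le_sum fun i _ => ?_
      rw [inner_map_self_of_eigen (he2 i), he1]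
      simpa using (em i).2.2
    rw [div_lt_iff₀ hr₀.1] at hn
    simp at h2
    linarith
  obtain ⟨r, hr, hmax⟩ := hfin.exists_maximal ⟨r₀, hr₀, le_refl r₀⟩
  refine ⟨r, hr.1, fun r' hr' => ?_⟩
  by_contra! hlt
  exact hlt.not_ge (hmax ⟨hr', (hr.2.trans hlt.le : r₀ ≤ r')⟩ hlt.le)

/-- A positive symmetric operator of finite trace has a spectral system. -/
theorem exists_isSpectralSystem {T : H →L[ℂ] H} (hT : (T : H →ₗ[ℂ] H).IsSymmetric)
    (hpos : ∀ x, 0 ≤ (inner ℂ x (T x)).re) {B : ℝ}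
    (hB : ∀ (e : ℕ → H) (n : ℕ), Orthonormal ℂ (fun i : Fin n => e i) →
      ∑ i ∈ Finset.range n, (inner ℂ (e i) (T (e i))).re ≤ B) :
    ∃ (N : ℕ∞) (lam : ℕ → ℝ) (h : ℕ → H), IsSpectralSystem T N lam h := by
  classical
  have hstep : ∀ s : Set H, ∃ p : ℝ × H, (orthEigenvalues T s).Nonempty →
      p.1 ∈ orthEigenvalues T s ∧ ‖p.2‖ = 1 ∧ T p.2 = (p.1 : ℂ) • p.2 ∧
      (∀ x ∈ s, inner ℂ x p.2 = 0) ∧ ∀ r' ∈ orthEigenvalues T s, r' ≤ p.1 := fun s => by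
    by_cases hs : (orthEigenvalues T s).Nonempty
    · obtain ⟨r, hr, hmax⟩ := exists_max_orthEigenvalues hT hB hs
      obtain ⟨h0, f, h1, h2, h3⟩ := hr
      exact ⟨(r, f), fun _ => ⟨⟨h0, f, h1, h2, h3⟩, h1, h2, h3, hmax⟩⟩
    · exact ⟨(0, 0), fun h => absurd h hs⟩
  choose nx hnx using hstep
  -- Greedy selection: `F n` holds the first `n` chosen eigenvectors, and the next one realizes the
  -- largest eigenvalue still available orthogonally to them.
  let F : ℕ → Set H := fun n => Nat.rec ∅ (fun _ s => insert (nx s).2 s) n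
  have hF : ∀ n, F (n + 1) = insert (nx (F n)).2 (F n) := fun _ => rfl
  have hFmono : Monotone F := monotone_nat_of_le_succ fun n => Set.subset_insert _ _
  let h : ℕ → H := fun n => (nx (F n)).2
  let lam : ℕ → ℝ := fun n => (nx (F n)).1
  have hmem : ∀ {j k}, j < k → h j ∈ F k := fun {j k} hjk =>
    hFmono (Nat.succ_le_of_lt hjk) (Set.mem_insert _ _)
  have hFsub : ∀ n, ∀ x ∈ F n, ∃ k < n, x = h k := fun n => by
    induction n with
    | zero => intro x hx; exact absurd hx (Set.notMem_empty x)
    | succ n ih =>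
      intro x hx
      rcases (Set.mem_insert_iff.1 (hF n ▸ hx)) with rfl | hx
      · exact ⟨n, n.lt_succ_self, rfl⟩
      · obtain ⟨k, hk, rfl⟩ := ih x hx
        exact ⟨k, hk.trans n.lt_succ_self, rfl⟩
  -- `N` is the first stage at which no eigenvalue is left, or `⊤` if there is no such stage.
  obtain ⟨N, hN, hN'⟩ : ∃ N : ℕ∞, (∀ k : ℕ, (k : ℕ∞) < N → (orthEigenvalues T (F k)).Nonempty) ∧
      (∀ n : ℕ, N = n → ¬ (orthEigenvalues T (F n)).Nonempty) := by
    by_cases hex : ∃ n, ¬ (orthEigenvalues T (F n)).Nonempty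
    · refine ⟨Nat.find hex, fun k hk => ?_, fun n hn => ?_⟩
      · exact not_not.1 (Nat.find_min hex (by exact_mod_cast hk))
      · have : Nat.find hex = n := by exact_mod_cast hn
        exact this ▸ Nat.find_spec hex
    · push Not at hex
      exact ⟨⊤, fun k _ => hex k, fun n hn => absurd hn.symm (ENat.natCast_ne_top n)⟩
  have hon : Orthonormal ℂ (fun k : {k : ℕ // (k : ℕ∞) < N} => h k) := by
    refine ⟨fun k => (hnx _ (hN k k.2)).2.1, fun j k hjk => ?_⟩
    have hjk' : (j : ℕ) ≠ k := fun h => hjk (Subtype.ext h)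
    rcases lt_or_gt_of_ne hjk' with hlt | hlt
    · exact (hnx _ (hN k k.2)).2.2.2.1 _ (hmem hlt)
    · exact inner_eq_zero_symm.1 ((hnx _ (hN j j.2)).2.2.2.1 _ (hmem hlt))
  have heig : ∀ k : ℕ, (k : ℕ∞) < N → T (h k) = (lam k : ℂ) • h k := fun k hk =>
    (hnx _ (hN k hk)).2.2.1
  refine ⟨N, lam, h, hon, heig, fun k hk => (hnx _ (hN k hk)).1.1.ne', fun j k hjk hk => ?_, ?_⟩
  · refine (hnx _ (hN j (lt_of_le_of_lt (by exact_mod_cast hjk) hk))).2.2.2.2 _ ?_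
    exact orthEigenvalues_antitone T (hFmono hjk) (hnx _ (hN k hk)).1
  · intro μ f hμ hf horth
    by_contra hf0
    obtain ⟨r, hr, rfl⟩ := exists_pos_eq_of_eigen hT hpos hμ hf0 hf
    -- An omitted eigenvector, normalized, is a candidate at every stage. For finite `N` this
    -- contradicts the stopping rule. For `N = ⊤` maximality makes every chosen eigenvalue at least
    -- `r`, which breaks the trace bound.
    have hmemr : ∀ n : ℕ, (n : ℕ∞) ≤ N → r ∈ orthEigenvalues T (F n) := fun n hn => by
      refine ⟨hr, ((‖f‖ : ℂ)⁻¹) • f, ?_, ?_, fun x hx => ?_⟩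
      · rw [norm_smul]; simp [hf0]
      · rw [map_smul, hf, smul_comm]
      · obtain ⟨k, hk, rfl⟩ := hFsub n x hx
        rw [inner_smul_right, horth k (lt_of_lt_of_le (by exact_mod_cast hk) hn), mul_zero]
    induction N using ENat.recTopCoe with
    | coe n => exact hN' n rfl ⟨r, hmemr n le_rfl⟩
    | top =>
      obtain ⟨n, hn⟩ := exists_nat_gt (B / r)
      have h1 := hB h n (hon.comp (fun i : Fin n => (⟨i, ENat.natCast_lt_top _⟩ : {k : ℕ // (k : ℕ∞) < ⊤}))
        fun i j hij => Fin.ext (by simpa using hij))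
      have h2 : ∑ i ∈ Finset.range n, r ≤
          ∑ i ∈ Finset.range n, (inner ℂ (h i) (T (h i))).re := by
        refine Finset.sum_le_sum fun i _ => ?_
        have hi := hnx _ (hN i (ENat.natCast_lt_top _))
        rw [inner_map_self_of_eigen (heig i (ENat.natCast_lt_top _)), hi.2.1]
        simpa using hi.2.2.2.2 _ (hmemr i le_top)
      rw [div_lt_iff₀ hr] at hn
      simp at h2
      linarith

variable [CompleteSpace H]

/-- A compact symmetric operator vanishes on the orthogonal complement of a spectral system. -/
theorem IsSpectralSystem.map_eq_zero {T : H →L[ℂ] H} {N : ℕ∞} {lam : ℕ → ℝ} {h : ℕ → H}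
    (hS : IsSpectralSystem T N lam h) (hT : (T : H →ₗ[ℂ] H).IsSymmetric)
    (hc : IsCompactOperator T) {f : H}
    (hf : ∀ k : ℕ, (k : ℕ∞) < N → inner ℂ (h k) f = 0) : T f = 0 := by
  let U : Submodule ℂ H := (Submodule.span ℂ (Set.range
    (fun k : {k : ℕ // (k : ℕ∞) < N} => h k)))ᗮ
  have hU : ∀ x, x ∈ U ↔ ∀ k : ℕ, (k : ℕ∞) < N → inner ℂ (h k) x = 0 := fun x => by
    constructor
    · intro hx k hk
      exact hx _ (Submodule.subset_span ⟨⟨k, hk⟩, rfl⟩)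
    · intro hx
      have : Submodule.span ℂ (Set.range (fun k : {k : ℕ // (k : ℕ∞) < N} => h k)) ≤
          (Submodule.span ℂ {x})ᗮ := by
        rw [Submodule.span_le]
        rintro _ ⟨k, rfl⟩
        rw [SetLike.mem_coe, Submodule.mem_orthogonal_singleton_iff_inner_left]
        exact hx k k.2
      intro u hu
      exact (Submodule.mem_orthogonal_singleton_iff_inner_left).1 (this hu)
  have hinv : ∀ x ∈ U, T x ∈ U := fun x hx => by
    rw [hU] at hx ⊢
    intro k hk
    have h1 : inner ℂ (T (h k)) x = inner ℂ (h k) (T x) := hT (h k) x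
    rw [← h1, hS.eigen k hk, inner_smul_left, hx k hk, mul_zero]
  -- The restriction to the invariant complement is compact and symmetric, and completeness leaves
  -- it no nonzero eigenvalue, so it vanishes.
  let S : U →L[ℂ] U := T.restrict hinv
  have hSc : IsCompactOperator S := hc.restrict' (f := (T : H →ₗ[ℂ] H)) hinv
  have hSs : (S : U →ₗ[ℂ] U).IsSymmetric := hT.restrict_invariant hinv
  have h0 : S = 0 := by
    rw [← ContinuousLinearMap.eq_zero_of_forall_hasEigenvalue_eq_zero hSc hSs]
    intro μ hμ
    by_contra hne
    obtain ⟨x, hx⟩ := hμ.exists_hasEigenvector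
    refine hx.2 (Subtype.ext ?_)
    have hx1 : S x = μ • x := hx.apply_eq_smul
    refine hS.complete μ x hne ?_ ((hU x).1 x.2)
    exact congrArg Subtype.val hx1
  have := congrArg (fun R : U →L[ℂ] U => (R ⟨f, (hU f).2 hf⟩ : H)) h0
  exact this

/-- Bessel's inequality makes the eigenvector expansion `p` of `f` converge, and `T` kills `f - p`.
Hence `⟨f, T f⟩ = ⟨f, T p⟩`, which can be computed term by term. -/
theorem IsSpectralSystem.hasSum {T : H →L[ℂ] H} {N : ℕ∞} {lam : ℕ → ℝ} {h : ℕ → H}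
    (hS : IsSpectralSystem T N lam h) (hT : (T : H →ₗ[ℂ] H).IsSymmetric)
    (hc : IsCompactOperator T) (f : H) :
    HasSum (fun k : {k : ℕ // (k : ℕ∞) < N} => lam k * ‖inner ℂ (h k) f‖ ^ 2)
      (inner ℂ f (T f)).re := by
  let e := fun k : {k : ℕ // (k : ℕ∞) < N} => h k
  have he : Orthonormal ℂ e := hS.orthonormal
  obtain ⟨p, hp⟩ : Summable fun k => (inner ℂ (e k) f) • e k := by
    have h1 := (he.orthogonalFamily).summable_iff_norm_sq_summable (fun k => inner ℂ (e k) f)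
    simp only [LinearIsometry.toSpanSingleton_apply] at h1
    exact h1.2 (he.inner_products_summable f)
  have hpq : ∀ k : ℕ, (k : ℕ∞) < N → inner ℂ (h k) (f - p) = 0 := fun k hk => by
    have h1 := hp.mapL (innerSL ℂ (h k))
    have h2 : HasSum (fun j => innerSL ℂ (h k) ((inner ℂ (e j) f) • e j)) (inner ℂ (h k) f) := by
      convert hasSum_single (f := fun j => innerSL ℂ (h k) ((inner ℂ (e j) f) • e j))
        ⟨k, hk⟩ ?_ using 1
      · simp [e, hS.orthonormal.1 ⟨k, hk⟩]
      · intro j hj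
        have : inner ℂ (h k) (e j) = 0 := he.2 (i := ⟨k, hk⟩) hj.symm
        simp [this]
    rw [inner_sub_right, ← h1.unique h2]
    simp
  have hTf : T f = T p := by
    have := hS.map_eq_zero hT hc hpq
    rwa [map_sub, sub_eq_zero] at this
  rw [hTf]
  have h3 := ((hp.mapL T).mapL (innerSL ℂ f)).mapL Complex.reCLM
  refine HasSum.congr_fun h3 fun k => ?_
  have h4 : T ((inner ℂ (e k) f) • e k) = inner ℂ (e k) f • (lam k : ℂ) • e k := by
    rw [map_smul, hS.eigen k k.2]
  have h5 : inner ℂ f (T ((inner ℂ (e k) f) • e k)) = ((lam k * ‖inner ℂ (e k) f‖ ^ 2 : ℝ) : ℂ) := by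
    rw [h4, inner_smul_right, inner_smul_right, ← inner_conj_symm f (e k)]
    have := RCLike.mul_conj (inner ℂ (e k) f)
    push_cast
    linear_combination (lam k : ℂ) * this
  exact (congrArg Complex.re h5).symm

end SpectralSystem

/-- Let `A = ⌈V⌉`, let `D` be the defect sum over `k < A`, and `S` the tail sum. Then `D - S = A -
V` lies in `[0,1)`. With `l A` as a threshold, monotonicity gives `l A * D + (1 - l A) * S ≤ τ`. The
left side is `S + l A * (A - V)`, so `S ≤ τ`, and `D + S = 2 S + (A - V) ≤ 2 τ + 1`. -/
theorem sum_one_sub_add_tail_le {l : ℕ → ℝ} (hl : Antitone l) (h1 : ∀ k, l k ≤ 1) {V τ : ℝ}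
    (hV : HasSum l V) (hτ : HasSum (fun k => l k * (1 - l k)) τ) :
    ∑ k ∈ Finset.range ⌈V⌉₊, (1 - l k) + ∑' k, l (k + ⌈V⌉₊) ≤ 1 + 2 * τ := by
  have h0 : ∀ k, 0 ≤ l k := fun k => hl.le_of_tendsto hV.summable.tendsto_atTop_zero k
  have hV0 : 0 ≤ V := hV.nonneg h0
  set A := ⌈V⌉₊
  have hA : V ≤ A := Nat.le_ceil V
  have hA' : (A : ℝ) < V + 1 := Nat.ceil_lt_add_one hV0
  have e1 := hV.summable.sum_add_tsum_nat_add A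
  have e2 := hτ.summable.sum_add_tsum_nat_add A
  rw [hV.tsum_eq] at e1
  rw [hτ.tsum_eq] at e2
  have e3 : ∑ k ∈ Finset.range A, (1 - l k) = A - ∑ k ∈ Finset.range A, l k := by simp
  have s1 : Summable fun k => l (k + A) := (summable_nat_add_iff A).2 hV.summable
  have s2 : Summable fun k => l (k + A) * (1 - l (k + A)) :=
    (summable_nat_add_iff A (f := fun k => l k * (1 - l k))).2 hτ.summable
  have t1 : l A * ∑ k ∈ Finset.range A, (1 - l k) ≤
      ∑ k ∈ Finset.range A, l k * (1 - l k) := by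
    rw [Finset.mul_sum]
    refine Finset.sum_le_sum fun k hk => ?_
    exact mul_le_mul_of_nonneg_right (hl (Finset.mem_range.1 hk).le) (by linarith [h1 k])
  have t2 : (1 - l A) * ∑' k, l (k + A) ≤ ∑' k, l (k + A) * (1 - l (k + A)) := by
    rw [← tsum_mul_left]
    refine (s1.mul_left _).tsum_le_tsum (fun k => ?_) s2
    have := hl (Nat.le_add_left A k)
    nlinarith [h0 (k + A)]
  rw [e3] at t1 ⊢
  have hS0 : 0 ≤ ∑' k, l (k + A) := tsum_nonneg fun k => h0 _
  nlinarith [h0 A, h1 A, mul_le_mul_of_nonneg_left hA (h0 A)]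

/-! ### Integrals of rank-one operators. -/

section FrameOp

variable {H : Type*} [NormedAddCommGroup H] [InnerProductSpace ℂ H]
  {X : Type*} [MeasurableSpace X] {ν : Measure X} {v : X → H}

/-- The operator `∫ ⟨v z, ·⟩ v z dν(z)`. -/
noncomputable def frameOp (v : X → H) (ν : Measure X) : H →L[ℂ] H :=
  ∫ z, InnerProductSpace.rankOne ℂ (v z) (v z) ∂ν

theorem isCompactOperator_rankOne (x y : H) :
    IsCompactOperator (InnerProductSpace.rankOne ℂ x y) := by
  rw [InnerProductSpace.rankOne_def']
  have hc : IsCompactOperator (innerSL ℂ y : H →L[ℂ] ℂ) :=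
    (isCompactOperator_id : IsCompactOperator (id : ℂ → ℂ)).comp_clm (innerSL ℂ y)
  exact hc.clm_comp (ContinuousLinearMap.toSpanSingleton ℂ x)

theorem frameOp_apply (hv : Integrable (fun z => InnerProductSpace.rankOne ℂ (v z) (v z)) ν)
    (f : H) : frameOp v ν f = ∫ z, inner ℂ (v z) f • v z ∂ν := by
  rw [frameOp, ContinuousLinearMap.integral_apply hv]
  simp

variable [CompleteSpace H]

theorem inner_frameOp (hv : Integrable (fun z => InnerProductSpace.rankOne ℂ (v z) (v z)) ν)
    (u f : H) : inner ℂ u (frameOp v ν f) = ∫ z, inner ℂ (v z) f * inner ℂ u (v z) ∂ν := by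
  have h1 : Integrable (fun z => inner ℂ (v z) f • v z) ν := by
    simpa using hv.apply_continuousLinearMap f
  rw [frameOp_apply hv, ← integral_inner h1]
  simp [inner_smul_right]

theorem inner_frameOp_self (hv : Integrable (fun z => InnerProductSpace.rankOne ℂ (v z) (v z)) ν)
    (f : H) : inner ℂ f (frameOp v ν f) = ((∫ z, ‖inner ℂ (v z) f‖ ^ 2 ∂ν : ℝ) : ℂ) := by
  rw [inner_frameOp hv, ← integral_complex_ofReal]
  congr 1 with z
  rw [← inner_conj_symm f (v z)]
  simpa using RCLike.mul_conj (inner ℂ (v z) f)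

theorem isSymmetric_frameOp
    (hv : Integrable (fun z => InnerProductSpace.rankOne ℂ (v z) (v z)) ν) :
    (frameOp v ν : H →ₗ[ℂ] H).IsSymmetric := by
  intro f u
  change inner ℂ (frameOp v ν f) u = inner ℂ f (frameOp v ν u)
  rw [← inner_conj_symm, inner_frameOp hv, inner_frameOp hv, ← integral_conj]
  congr 1 with z
  rw [map_mul, inner_conj_symm, inner_conj_symm, mul_comm]

/-- Compact operators form a closed convex set, so it contains the average of an integrable family
of rank-one operators. The integral is a multiple of that average once `ν ≠ 0`. -/
theorem isCompactOperator_frameOp [IsFiniteMeasure ν]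
    (hv : Integrable (fun z => InnerProductSpace.rankOne ℂ (v z) (v z)) ν) :
    IsCompactOperator (frameOp v ν) := by
  rcases eq_or_ne ν 0 with rfl | hν
  · simpa [frameOp] using (isCompactOperator_zero : IsCompactOperator (0 : H → H))
  have : NeZero ν := ⟨hν⟩
  have hconv : Convex ℝ {T : H →L[ℂ] H | IsCompactOperator T} := by
    intro S hS T hT a b _ _ _
    exact (hS.smul a).add (hT.smul b)
  have h1 := hconv.average_mem isClosed_setOfPred_isCompactOperator
    (Filter.Eventually.of_forall fun z => isCompactOperator_rankOne (v z) (v z)) hv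
  rw [frameOp, ← measure_smul_average]
  exact IsCompactOperator.smul h1 _

end FrameOp

open Filter Topology

/-! ### Translates of functions of bounded variation. -/

section BoundedVariation

theorem divergence_smul_const {F : Type*} [NormedAddCommGroup F] [NormedSpace ℝ F]
    [FiniteDimensional ℝ F] {ψ : F → ℝ} (w x : F) (hψ : DifferentiableAt ℝ ψ x) :
    divergence (fun y => ψ y • w) x = fderiv ℝ ψ x w := by
  rw [divergence, fderiv_smul_const hψ]
  exact LinearMap.trace_smulRight _ _

variable {F : Type*} [NormedAddCommGroup F] [InnerProductSpace ℝ F]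
    [FiniteDimensional ℝ F] [MeasurableSpace F] [BorelSpace F]

/-- The field `ψ · w/‖w‖` is admissible in the variation, and its divergence is the derivative of
`ψ` along `w/‖w‖`. -/
theorem integral_mul_fderiv_le_variation {f ψ : F → ℝ} (hψ : ContDiff ℝ 1 ψ)
    (hc : HasCompactSupport ψ) (h1 : ∀ x, |ψ x| ≤ 1) (hf : variation f ≠ ∞) (w : F) :
    ∫ x, f x * fderiv ℝ ψ x w ≤ ‖w‖ * (variation f).toReal := by
  rcases eq_or_ne w 0 with rfl | hw
  · simp
  have hw' : 0 < ‖w‖ := norm_pos_iff.2 hw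
  have hle : ENNReal.ofReal (∫ x, f x * divergence (fun y => ψ y • (‖w‖⁻¹ • w)) x) ≤
      variation f := by
    refine le_iSup₂_of_le (fun y => ψ y • (‖w‖⁻¹ • w))
      ⟨hψ.smul contDiff_const, hc.smul_right, fun x => ?_⟩ le_rfl
    rw [norm_smul, norm_smul, norm_inv, norm_norm, inv_mul_cancel₀ hw'.ne', mul_one]
    exact h1 x
  rw [ENNReal.ofReal_le_iff_le_toReal hf] at hle
  have he : ∫ x, f x * divergence (fun y => ψ y • (‖w‖⁻¹ • w)) x =
      ‖w‖⁻¹ * ∫ x, f x * fderiv ℝ ψ x w := by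
    rw [← integral_const_mul]
    congr 1 with x
    rw [divergence_smul_const _ _ (hψ.differentiable one_ne_zero x), map_smul, smul_eq_mul]
    ring
  rwa [he, inv_mul_le_iff₀ hw'] at hle

/-- Pairing a difference of translates of `f` with a test function. -/
theorem integral_mul_sub_translate_le {f ψ : F → ℝ} (hψ : ContDiff ℝ 1 ψ)
    (hc : HasCompactSupport ψ) (h1 : ∀ x, |ψ x| ≤ 1) (hfi : Integrable f) (hf : variation f ≠ ∞)
    (w : F) : ∫ x, f x * (ψ (x + w) - ψ x) ≤ ‖w‖ * (variation f).toReal := by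
  have hd : Continuous (fderiv ℝ ψ) := hψ.continuous_fderiv one_ne_zero
  obtain ⟨K, hK⟩ := (hc.fderiv (𝕜 := ℝ)).exists_bound_of_continuous hd
  -- The mean value inequality for `G` on `[0,1]` gives the bound: each derivative of `G` is a
  -- pairing of `f` with a directional derivative of a translate of `ψ`, again a test function.
  let G : ℝ → ℝ := fun s => ∫ x, f x * ψ (x + s • w)
  have hint : ∀ s : ℝ, Integrable fun x => f x * ψ (x + s • w) := fun s =>
    hfi.mul_bdd (c := 1) (hψ.continuous.comp (by fun_prop)).aestronglyMeasurable
      (Eventually.of_forall fun x => h1 _)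
  have hG : ∀ s, HasDerivAt G (∫ x, f x * fderiv ℝ ψ (x + s • w) w) s := fun s => by
    refine (hasDerivAt_integral_of_dominated_loc_of_deriv_le (s := Set.univ)
      (bound := fun x => ‖f x‖ * (K * ‖w‖))
      (F' := fun t x => f x * fderiv ℝ ψ (x + t • w) w) Filter.univ_mem
      (Eventually.of_forall fun t => (hint t).aestronglyMeasurable) (hint s) ?_
      (Eventually.of_forall fun x t _ => ?_) (hfi.norm.mul_const _)
      (Eventually.of_forall fun x t _ => ?_)).2
    · refine hfi.aestronglyMeasurable.mul (Continuous.aestronglyMeasurable ?_)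
      exact (hd.comp (by fun_prop)).clm_apply continuous_const
    · rw [norm_mul]
      gcongr
      exact (ContinuousLinearMap.le_opNorm _ _).trans (by gcongr; exact hK _)
    · have h2 : HasDerivAt (fun t : ℝ => x + t • w) w t := by
        simpa using ((hasDerivAt_id t).smul_const w).const_add x
      exact ((hψ.differentiable one_ne_zero _).hasFDerivAt.comp_hasDerivAt t h2).const_mul _
  have hG' : ∀ s : ℝ, ∫ x, f x * fderiv ℝ ψ (x + s • w) w ≤ ‖w‖ * (variation f).toReal := fun s => by
    have := integral_mul_fderiv_le_variation (f := f) (ψ := fun x => ψ (x + s • w))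
      (hψ.comp (contDiff_id.add contDiff_const))
      (hc.comp_homeomorph (Homeomorph.addRight (s • w))) (fun x => h1 _) hf w
    simpa only [fderiv_comp_add_right] using this
  have h2 : G 1 - G 0 ≤ ‖w‖ * (variation f).toReal * (1 - 0) :=
    image_sub_le_mul_sub_of_deriv_le (fun s => (hG s).differentiableAt)
      (fun s => by rw [(hG s).deriv]; exact hG' s) zero_le_one
  have h3 : ∫ x, f x * (ψ (x + w) - ψ x) = G 1 - G 0 := by
    rw [← integral_sub (hint 1) (hint 0)]
    congr 1 with x
    simp [mul_sub]
  rw [h3]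
  simpa using h2

/-- The `L¹` norm of a compactly supported function is bounded by its pairings with test
functions. -/
theorem integral_abs_le_of_forall_contDiff {f : F → ℝ} (hf : Integrable f)
    (hfc : HasCompactSupport f) {B : ℝ}
    (hB : ∀ ψ : F → ℝ, ContDiff ℝ 1 ψ → HasCompactSupport ψ → (∀ x, |ψ x| ≤ 1) →
      ∫ x, f x * ψ x ≤ B) : ∫ x, |f x| ≤ B := by
  -- The sign of `f`, equal to 0 where `f` vanishes because `0⁻¹ = 0`. Its mollifications are the
  -- test functions.
  let σ : F → ℝ := fun x => f x * |f x|⁻¹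
  have hσ1 : ∀ x, |σ x| ≤ 1 := fun x => by
    simp only [σ, abs_mul, abs_inv, abs_abs]
    exact mul_inv_le_one
  have hσf : ∀ x, f x * σ x = |f x| := fun x => by
    rcases eq_or_ne (f x) 0 with h | h
    · simp [h]
    · have : |f x| ≠ 0 := abs_ne_zero.2 h
      simp only [σ]
      rw [← mul_assoc, ← abs_mul_abs_self, mul_inv_cancel_right₀ this]
  have hσc : HasCompactSupport σ := hfc.mul_right
  have hσm : AEStronglyMeasurable σ volume := hf.aestronglyMeasurable.mul
    (hf.aestronglyMeasurable.aemeasurable.abs.inv).aestronglyMeasurable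
  have hσl : LocallyIntegrable σ volume :=
    (memLp_top_of_bound hσm 1 (Eventually.of_forall hσ1)).locallyIntegrable le_top
  -- The ratio of outer to inner radius stays equal to 2, as required for almost everywhere
  -- convergence of the mollifications.
  let φ : ℕ → ContDiffBump (0 : F) := fun n =>
    ⟨((n : ℝ) + 1)⁻¹ / 2, ((n : ℝ) + 1)⁻¹, by positivity, half_lt_self (by positivity)⟩
  let ψ : ℕ → F → ℝ := fun n =>
    convolution ((φ n).normed volume) σ (ContinuousLinearMap.lsmul ℝ ℝ) volume
  have hψ1 : ∀ n x, |ψ n x| ≤ 1 := fun n x => by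
    have h : ‖∫ t, ContinuousLinearMap.lsmul ℝ ℝ ((φ n).normed volume t) (σ (x - t))‖ ≤
        ∫ t, (φ n).normed volume t := by
      refine norm_integral_le_of_norm_le (φ n).integrable_normed (Eventually.of_forall fun t => ?_)
      have h0 := (φ n).nonneg_normed (μ := volume) t
      rw [ContinuousLinearMap.lsmul_apply, norm_smul, Real.norm_of_nonneg h0]
      exact mul_le_of_le_one_right h0 (hσ1 _)
    rw [(φ n).integral_normed] at h
    exact h
  have hψd : ∀ n, ContDiff ℝ 1 (ψ n) := fun n =>
    (φ n).hasCompactSupport_normed.contDiff_convolution_left _ (φ n).contDiff_normed hσl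
  have hψc : ∀ n, HasCompactSupport (ψ n) := fun n =>
    (φ n).hasCompactSupport_normed.convolution _ hσc
  have hlim : ∀ᵐ x, Tendsto (fun n => ψ n x) atTop (𝓝 (σ x)) :=
    ContDiffBump.ae_convolution_tendsto_right_of_locallyIntegrable (K := 2)
      (by simpa [φ] using tendsto_one_div_add_atTop_nhds_zero_nat (𝕜 := ℝ))
      (Eventually.of_forall fun n => by simp only [φ]; linarith) hσl
  have hT : Tendsto (fun n => ∫ x, f x * ψ n x) atTop (𝓝 (∫ x, f x * σ x)) := by
    refine tendsto_integral_of_dominated_convergence (fun x => ‖f x‖)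
      (fun n => hf.aestronglyMeasurable.mul (hψd n).continuous.aestronglyMeasurable) hf.norm
      (fun n => Eventually.of_forall fun x => ?_) ?_
    · rw [norm_mul]
      exact mul_le_of_le_one_right (norm_nonneg _) (hψ1 n x)
    · filter_upwards [hlim] with x hx using hx.const_mul _
  simp only [hσf] at hT
  exact le_of_tendsto' hT fun n => hB _ (hψd n) (hψc n) (hψ1 n)

/-- By duality: a change of variables moves the translation by `w` from `f` to a translation by `-w`
of the test function. -/
theorem integral_abs_translate_sub_le {f : F → ℝ} (hfi : Integrable f) (hfc : HasCompactSupport f)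
    (hf : variation f ≠ ∞) (w : F) :
    ∫ x, |f (x + w) - f x| ≤ ‖w‖ * (variation f).toReal := by
  refine integral_abs_le_of_forall_contDiff ((hfi.comp_add_right w).sub hfi)
    ((hfc.comp_homeomorph (Homeomorph.addRight w)).sub hfc) fun ψ hψ hc h1 => ?_
  have hb : ∀ y : F, Integrable fun x => f x * ψ (x + y) := fun y =>
    hfi.mul_bdd (c := 1) (hψ.continuous.comp (by fun_prop)).aestronglyMeasurable
      (Eventually.of_forall fun x => h1 _)
  have h2 := integral_mul_sub_translate_le hψ hc h1 hfi hf (-w)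
  have h3 : ∫ x, (f (x + w) - f x) * ψ x = ∫ x, f x * (ψ (x + -w) - ψ x) := by
    have e1 : ∫ x, f (x + w) * ψ x = ∫ x, f x * ψ (x + -w) := by
      rw [← integral_add_right_eq_self (fun x => f x * ψ (x + -w)) w]
      simp
    have e2 : Integrable fun x => f (x + w) * ψ x := by
      simpa using (hb (-w)).comp_add_right w
    simp only [sub_mul, mul_sub]
    rw [integral_sub e2 (by simpa using hb 0), integral_sub (hb (-w)) (by simpa using hb 0), e1]
  rw [norm_neg, ← h3] at h2
  exact h2

end BoundedVariation

/-! ### Plancherel's theorem for Fourier integrals. -/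

section Plancherel

open FourierTransform SchwartzMap

variable {E : Type*} [NormedAddCommGroup E] [InnerProductSpace ℝ E] [FiniteDimensional ℝ E]
  [MeasurableSpace E] [BorelSpace E]

/-- The `L²` Fourier transform of an integrable function is given by the Fourier integral. -/
theorem coeFn_fourier_toLp_ae_eq {F : E → ℂ} (h1 : Integrable F) (h2 : MemLp F 2) :
    (𝓕 (h2.toLp F) : Lp ℂ 2 (volume : Measure E)) =ᵐ[volume] 𝓕 F := by
  have hcont : Continuous (𝓕 F) :=
    VectorFourier.fourierIntegral_continuous Real.continuous_fourierChar
      (by exact continuous_inner) h1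
  refine ae_eq_of_integral_contDiff_smul_eq
    ((Lp.memLp _).locallyIntegrable one_le_two) hcont.locallyIntegrable fun φ hφ hc => ?_
  -- Both transforms, tested against `φ`, give the integral of `F` against the Fourier transform of
  -- `φ`: one by the definition of the distributional transform, the other by the multiplication
  -- formula.
  let φ' : 𝓢(E, ℂ) := HasCompactSupport.toSchwartzMap (f := fun x => (φ x : ℂ))
    (hc.comp_left (g := fun r : ℝ => (r : ℂ)) Complex.ofReal_zero) (Complex.ofRealCLM.contDiff.comp hφ)
  have e1 := congrArg (fun u : 𝓢'(E, ℂ) => u φ') (Lp.fourier_toTemperedDistribution_eq (h2.toLp F))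
  simp only [TemperedDistribution.fourier_apply, Lp.toTemperedDistribution_apply] at e1
  have e2 : ∫ x, (𝓕 φ' : 𝓢(E, ℂ)) x • (h2.toLp F) x = ∫ x, (𝓕 φ' : 𝓢(E, ℂ)) x • F x :=
    integral_congr_ae (h2.coeFn_toLp.mono fun x hx => by simp only [hx])
  have e3 : ∫ x, (𝓕 φ' : 𝓢(E, ℂ)) x • F x = ∫ x, φ' x • 𝓕 F x := by
    have := VectorFourier.integral_fourierIntegral_smul_eq_flip (μ := (volume : Measure E))
      (ν := (volume : Measure E)) (L := innerₗ E) (f := φ') (g := F)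
      Real.continuous_fourierChar (by exact continuous_inner) φ'.integrable h1
    rw [flip_innerₗ] at this
    exact this
  rw [e2, e3] at e1
  simp only [smul_eq_mul] at e1
  simp only [Complex.real_smul]
  exact e1.symm

/-- **Plancherel's theorem** for functions in `L¹ ∩ L²`. -/
theorem lintegral_enorm_fourier_sq {F : E → ℂ} (h1 : Integrable F) (h2 : MemLp F 2) :
    ∫⁻ ξ, ‖𝓕 F ξ‖ₑ ^ 2 = ∫⁻ t, ‖F t‖ₑ ^ 2 := by
  have h := Lp.norm_fourier_eq (h2.toLp F)
  have h' : eLpNorm (𝓕 F) 2 volume = eLpNorm F 2 volume := by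
    rw [← eLpNorm_congr_ae (coeFn_fourier_toLp_ae_eq h1 h2), ← eLpNorm_congr_ae h2.coeFn_toLp,
      ← Lp.enorm_def, ← Lp.enorm_def, ← ofReal_norm, h, ofReal_norm]
  rw [eLpNorm_eq_lintegral_rpow_enorm_toReal two_ne_zero ENNReal.ofNat_ne_top,
    eLpNorm_eq_lintegral_rpow_enorm_toReal two_ne_zero ENNReal.ofNat_ne_top] at h'
  simpa using ENNReal.rpow_left_injective (by norm_num) h'

end Plancherel

/-! ### Time-frequency shifts and the short-time Fourier transform. -/

section TimeFrequency

variable {d : ℕ}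

local notation "𝔼" => EuclideanSpace ℝ (Fin d)

theorem norm_exp_two_pi_I (r : ℝ) : ‖Complex.exp (2 * Real.pi * Complex.I * r)‖ = 1 := by
  rw [show (2 * Real.pi * Complex.I * r : ℂ) = ((2 * Real.pi * r : ℝ) : ℂ) * Complex.I by
    push_cast; ring]
  exact Complex.norm_exp_ofReal_mul_I _

theorem conj_exp_two_pi_I (r : ℝ) : conj (Complex.exp (2 * Real.pi * Complex.I * r)) =
    Complex.exp (-(2 * Real.pi * Complex.I * r)) := by
  rw [← Complex.exp_conj]
  simp [Complex.conj_ofNat]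

theorem continuous_exp_inner : Continuous fun p : 𝔼 × 𝔼 =>
    Complex.exp (2 * Real.pi * Complex.I * (inner ℝ p.1 p.2 : ℝ)) := by
  fun_prop

theorem memLp_modulate (ξ : 𝔼) (G : L2Space d) : MemLp (fun t =>
    Complex.exp (2 * Real.pi * Complex.I * (inner ℝ ξ t : ℝ)) * G t) 2 := by
  refine (Lp.memLp G).of_le ?_ (Eventually.of_forall fun t => ?_)
  · exact (continuous_exp_inner.comp (by fun_prop : Continuous fun t : 𝔼 => (ξ, t))
      ).aestronglyMeasurable.mul (Lp.aestronglyMeasurable G)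
  · rw [norm_mul, norm_exp_two_pi_I, one_mul]

/-- Modulation `e^{2πi ξ·t} G(t)`. -/
noncomputable def modulate (ξ : 𝔼) (G : L2Space d) : L2Space d := (memLp_modulate ξ G).toLp _

theorem coeFn_modulate (ξ : 𝔼) (G : L2Space d) : modulate ξ G =ᵐ[volume] fun t =>
    Complex.exp (2 * Real.pi * Complex.I * (inner ℝ ξ t : ℝ)) * G t :=
  (memLp_modulate ξ G).coeFn_toLp

theorem norm_modulate_sub (ξ : 𝔼) (G G' : L2Space d) :
    ‖modulate ξ G - modulate ξ G'‖ = ‖G - G'‖ := by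
  rw [Lp.norm_def, Lp.norm_def]
  congr 1
  refine eLpNorm_congr_norm_ae ?_
  filter_upwards [coeFn_modulate ξ G, coeFn_modulate ξ G', Lp.coeFn_sub G G',
    Lp.coeFn_sub (modulate ξ G) (modulate ξ G')] with t h1 h2 h3 h4
  rw [h3, h4, Pi.sub_apply, Pi.sub_apply, h1, h2, ← mul_sub, norm_mul, norm_exp_two_pi_I, one_mul]

theorem continuous_modulate_left (G : L2Space d) : Continuous fun ξ : 𝔼 => modulate ξ G := by
  refine continuous_iff_continuousAt.2 fun ξ₀ => ?_
  refine (Lp.tendsto_Lp_iff_tendsto_eLpNorm' _ _).2 ?_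
  have h1 : ∀ ξ : 𝔼, eLpNorm (⇑(modulate ξ G) - ⇑(modulate ξ₀ G)) 2 volume =
      (∫⁻ t, ‖(Complex.exp (2 * Real.pi * Complex.I * (inner ℝ ξ t : ℝ)) -
        Complex.exp (2 * Real.pi * Complex.I * (inner ℝ ξ₀ t : ℝ))) * G t‖ₑ ^ (2 : ℝ)) ^
        (1 / 2 : ℝ) := fun ξ => by
    rw [eLpNorm_eq_lintegral_rpow_enorm_toReal two_ne_zero ENNReal.ofNat_ne_top]
    simp only [ENNReal.toReal_ofNat]
    congr 1
    refine lintegral_congr_ae ?_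
    filter_upwards [coeFn_modulate ξ G, coeFn_modulate ξ₀ G] with t h1 h2
    rw [Pi.sub_apply, h1, h2, sub_mul]
  simp only [h1]
  have hlim : Tendsto (fun ξ : 𝔼 =>
      ∫⁻ t, ‖(Complex.exp (2 * Real.pi * Complex.I * (inner ℝ ξ t : ℝ)) -
        Complex.exp (2 * Real.pi * Complex.I * (inner ℝ ξ₀ t : ℝ))) * G t‖ₑ ^ (2 : ℝ)) (𝓝 ξ₀)
      (𝓝 (∫⁻ _ : 𝔼, 0)) := by
    -- A difference of two unimodular exponentials has modulus at most 2.
    refine tendsto_lintegral_filter_of_dominated_convergence (fun t => (2 * ‖G t‖ₑ) ^ (2 : ℝ))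
      (Eventually.of_forall fun ξ => ?_)
      (Eventually.of_forall fun ξ => Eventually.of_forall fun t => ?_) ?_
      (Eventually.of_forall fun t => ?_)
    · have hG : Measurable G := (Lp.stronglyMeasurable G).measurable
      fun_prop
    · rw [enorm_mul]
      gcongr
      refine (enorm_sub_le).trans ?_
      rw [← ofReal_norm, ← ofReal_norm, norm_exp_two_pi_I, norm_exp_two_pi_I]
      norm_num
    · have h2 := (Lp.memLp G).const_smul (2 : ℂ)
      have h3 := lintegral_rpow_enorm_lt_top_of_eLpNorm_lt_top two_ne_zero ENNReal.ofNat_ne_top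
        h2.eLpNorm_lt_top
      simp only [ENNReal.toReal_ofNat, Pi.smul_apply, enorm_smul] at h3
      have h4 : ‖(2 : ℂ)‖ₑ = 2 := by simp [← ofReal_norm]
      rw [h4] at h3
      exact h3.ne
    · have hc : Continuous fun ξ : 𝔼 =>
        ‖(Complex.exp (2 * Real.pi * Complex.I * (inner ℝ ξ t : ℝ)) -
        Complex.exp (2 * Real.pi * Complex.I * (inner ℝ ξ₀ t : ℝ))) * G t‖ₑ ^ (2 : ℝ) := by
        refine ENNReal.continuous_rpow_const.comp (continuous_enorm.comp ?_)
        fun_prop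
      simpa using hc.tendsto ξ₀
  simpa [Function.comp_def] using (ENNReal.continuous_rpow_const (y := (1 / 2 : ℝ))).continuousAt.tendsto.comp hlim

/-- Translation `G(t - x)`. -/
noncomputable def translateL2 (x : 𝔼) (G : L2Space d) : L2Space d :=
  Lp.compMeasurePreserving (fun t => t - x) (measurePreserving_sub_right volume x) G

theorem coeFn_translateL2 (x : 𝔼) (G : L2Space d) : translateL2 x G =ᵐ[volume] fun t => G (t - x) :=
  Lp.coeFn_compMeasurePreserving G (measurePreserving_sub_right volume x)

theorem continuous_translateL2_left (G : L2Space d) : Continuous fun x : 𝔼 => translateL2 x G := by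
  have hc : Continuous fun x : 𝔼 => (⟨fun t => t - x, by fun_prop⟩ : C(𝔼, 𝔼)) :=
    ContinuousMap.continuous_of_continuous_uncurry _ (by
      change Continuous fun p : 𝔼 × 𝔼 => p.2 - p.1
      fun_prop)
  exact Continuous.compMeasurePreservingLp (f := fun _ => G) continuous_const hc
    (fun x => measurePreserving_sub_right volume x) ENNReal.ofNat_ne_top

/-- The time-frequency shift `e^{2πi ξ·t} g(t - x)`. -/
noncomputable def tfShift (g : L2Space d) (z : PhaseSpace d) : L2Space d :=
  modulate z.snd (translateL2 z.fst g)

theorem coeFn_tfShift (g : L2Space d) (z : PhaseSpace d) : tfShift g z =ᵐ[volume] fun t =>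
    Complex.exp (2 * Real.pi * Complex.I * (inner ℝ z.snd t : ℝ)) * g (t - z.fst) := by
  filter_upwards [coeFn_modulate z.snd (translateL2 z.fst g), coeFn_translateL2 z.fst g] with t h1 h2
  rw [tfShift, h1, h2]

/-- Modulation is isometric, so a change of `x` costs the same at every frequency and the two
variables can be treated separately. Norm continuity is what makes the projections onto `π(z)g`
integrable over a compact set. -/
theorem continuous_tfShift (g : L2Space d) : Continuous (tfShift g) := by
  have hf : Continuous fun z : PhaseSpace d => z.fst :=
    continuous_fst.comp (WithLp.prod_continuous_ofLp 2 _ _)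
  have hs : Continuous fun z : PhaseSpace d => z.snd :=
    continuous_snd.comp (WithLp.prod_continuous_ofLp 2 _ _)
  refine continuous_iff_continuousAt.2 fun z₀ => tendsto_iff_norm_sub_tendsto_zero.2 ?_
  have h1 := ((continuous_translateL2_left g).comp hf).tendsto z₀
  have h2 := ((continuous_modulate_left (translateL2 z₀.fst g)).comp hs).tendsto z₀
  have h3 := (tendsto_iff_norm_sub_tendsto_zero.1 h1).add (tendsto_iff_norm_sub_tendsto_zero.1 h2)
  rw [add_zero] at h3
  refine squeeze_zero (fun _ => norm_nonneg _) (fun z => ?_) h3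
  refine (norm_sub_le_norm_sub_add_norm_sub _ (modulate z.snd (translateL2 z₀.fst g)) _).trans ?_
  rw [tfShift, norm_modulate_sub]
  rfl

theorem stft_eq_inner (g f : L2Space d) (z : PhaseSpace d) :
    stft g f z = inner ℂ (tfShift g z) f := by
  rw [stft, L2.inner_def]
  refine integral_congr_ae ?_
  filter_upwards [coeFn_tfShift g z] with t h
  rw [h, RCLike.inner_apply, map_mul, conj_exp_two_pi_I]
  ring

theorem norm_tfShift (g : L2Space d) (z : PhaseSpace d) : ‖tfShift g z‖ = ‖g‖ := by
  have h0 : modulate z.snd (0 : L2Space d) = 0 := by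
    refine (Lp.ext ?_)
    filter_upwards [coeFn_modulate z.snd (0 : L2Space d), Lp.coeFn_zero ℂ 2
      (volume : Measure 𝔼)] with t h1 h2
    rw [h1, h2, Pi.zero_apply, mul_zero]
  have h1 := norm_modulate_sub z.snd (translateL2 z.fst g) 0
  rw [h0, sub_zero, sub_zero] at h1
  rw [tfShift, h1, translateL2, Lp.norm_compMeasurePreserving]

theorem continuous_stft (g f : L2Space d) : Continuous (stft g f) := by
  have : stft g f = fun z => inner ℂ (tfShift g z) f := funext (stft_eq_inner g f)
  rw [this]
  exact (continuous_tfShift g).inner continuous_const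

theorem norm_stft_le (g f : L2Space d) (z : PhaseSpace d) : ‖stft g f z‖ ≤ ‖g‖ * ‖f‖ := by
  rw [stft_eq_inner, ← norm_tfShift g z]
  exact norm_inner_le_norm _ _

/-- Time-frequency shifts compose up to a phase, seen by the substitution `t ↦ t + x` with `x` the
time component of `z`. In modulus the reproducing kernel therefore depends only on `w - z`, which
turns `K` into a convolution kernel. -/
theorem norm_inner_tfShift (g : L2Space d) (w z : PhaseSpace d) :
    ‖inner ℂ (tfShift g w) (tfShift g z)‖ = ‖stft g g (w - z)‖ := by
  have h1 : inner ℂ (tfShift g w) (tfShift g z) =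
      Complex.exp (2 * Real.pi * Complex.I * ((- inner ℝ (w.snd - z.snd) z.fst : ℝ) : ℂ)) *
        stft g g (w - z) := by
    rw [L2.inner_def, stft, ← integral_const_mul]
    have h2 : ∫ t, inner ℂ (tfShift g w t) (tfShift g z t) =
        ∫ t, (Complex.exp (2 * Real.pi * Complex.I * (inner ℝ z.snd t : ℝ)) * g (t - z.fst)) *
          conj (Complex.exp (2 * Real.pi * Complex.I * (inner ℝ w.snd t : ℝ)) *
            g (t - w.fst)) := by
      refine integral_congr_ae ?_
      filter_upwards [coeFn_tfShift g w, coeFn_tfShift g z] with t h3 h4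
      rw [h3, h4, RCLike.inner_apply]
    rw [h2, ← integral_add_right_eq_self _ z.fst]
    congr 1 with t
    have h5 : t + z.fst - w.fst = t - (w - z).fst := by
      rw [WithLp.sub_fst]; abel
    rw [add_sub_cancel_right, h5, map_mul, conj_exp_two_pi_I, WithLp.sub_snd]
    have h6 : Complex.exp (2 * Real.pi * Complex.I * (inner ℝ z.snd (t + z.fst) : ℝ)) *
        Complex.exp (-(2 * Real.pi * Complex.I * (inner ℝ w.snd (t + z.fst) : ℝ))) =
        Complex.exp (2 * Real.pi * Complex.I * ((- inner ℝ (w.snd - z.snd) z.fst : ℝ) : ℂ)) *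
        Complex.exp (-(2 * Real.pi * Complex.I * (inner ℝ (w.snd - z.snd) t : ℝ))) := by
      rw [← Complex.exp_add, ← Complex.exp_add, inner_add_right, inner_add_right, inner_sub_left,
        inner_sub_left]
      congr 1
      push_cast
      ring
    linear_combination (g t * conj (g (t - (w - z).fst))) * h6
  rw [h1, norm_mul, norm_exp_two_pi_I, one_mul]

end TimeFrequency

/-! ### Moyal's formula. -/

section Moyal

variable {d : ℕ}

local notation "𝔼" => EuclideanSpace ℝ (Fin d)

theorem lintegral_enorm_sq_L2 (f : L2Space d) : ∫⁻ t, ‖f t‖ₑ ^ 2 = ENNReal.ofReal (‖f‖ ^ 2) := by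
  have h : ‖f‖ₑ = eLpNorm f 2 volume := Lp.enorm_def f
  rw [eLpNorm_eq_lintegral_rpow_enorm_toReal two_ne_zero ENNReal.ofNat_ne_top] at h
  rw [ENNReal.ofReal_pow (norm_nonneg _), ofReal_norm, h, ← ENNReal.rpow_ofNat, ← ENNReal.rpow_mul]
  simp

/-- **Moyal's formula**: the short-time Fourier transform is isometric up to the factor `‖g‖`. -/
theorem lintegral_enorm_stft_sq (g f : L2Space d) :
    ∫⁻ z : PhaseSpace d, ‖stft g f z‖ₑ ^ 2 = ENNReal.ofReal (‖g‖ ^ 2) * ENNReal.ofReal (‖f‖ ^ 2) := by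
  have hgm : Measurable g := (Lp.stronglyMeasurable g).measurable
  have hfm : Measurable f := (Lp.stronglyMeasurable f).measurable
  have hmp := WithLp.volume_preserving_symm_measurableEquiv_toLp_prod 𝔼 𝔼
  have e1 : ∫⁻ z : PhaseSpace d, ‖stft g f z‖ₑ ^ 2 =
      ∫⁻ p : 𝔼 × 𝔼, ‖stft g f (WithLp.toLp 2 p)‖ₑ ^ 2 :=
    (hmp.lintegral_comp_emb (MeasurableEquiv.measurableEmbedding _)
      (fun p => ‖stft g f (WithLp.toLp 2 p)‖ₑ ^ 2))
  have hc : Continuous fun p : 𝔼 × 𝔼 => ‖stft g f (WithLp.toLp 2 p)‖ₑ ^ 2 :=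
    (ENNReal.continuous_pow 2).comp
      (continuous_enorm.comp ((continuous_stft g f).comp (WithLp.prod_continuous_toLp 2 _ _)))
  rw [e1, Measure.volume_eq_prod, lintegral_prod _ hc.measurable.aemeasurable]
  have hm : Measurable fun p : 𝔼 × 𝔼 => ‖f p.2 * conj (g (p.2 - p.1))‖ₑ ^ 2 := by
    have : Measurable fun p : 𝔼 × 𝔼 => conj (g (p.2 - p.1)) :=
      Complex.continuous_conj.measurable.comp (hgm.comp (measurable_snd.sub measurable_fst))
    fun_prop
  have e2 : ∫⁻ x : 𝔼, ∫⁻ t : 𝔼, ‖f t * conj (g (t - x))‖ₑ ^ 2 =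
      ENNReal.ofReal (‖g‖ ^ 2) * ENNReal.ofReal (‖f‖ ^ 2) := by
    rw [lintegral_lintegral_swap hm.aemeasurable]
    have : ∀ t : 𝔼, ∫⁻ x : 𝔼, ‖f t * conj (g (t - x))‖ₑ ^ 2 =
        ENNReal.ofReal (‖g‖ ^ 2) * ‖f t‖ₑ ^ 2 := fun t => by
      simp only [enorm_mul, mul_pow, RCLike.enorm_conj]
      rw [lintegral_const_mul, lintegral_sub_left_eq_self (fun x => ‖g x‖ₑ ^ 2) t,
        lintegral_enorm_sq_L2, mul_comm]
      fun_prop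
    simp only [this]
    rw [lintegral_const_mul _ (by fun_prop), lintegral_enorm_sq_L2]
  rw [← e2]
  -- For fixed `x` the transform is a Fourier integral of `f · conj g(· - x)`. This product is
  -- always integrable but is known to be square integrable only for almost every `x`, which
  -- suffices for Plancherel in the inner integral.
  have hfin : ∀ᵐ x : 𝔼, ∫⁻ t : 𝔼, ‖f t * conj (g (t - x))‖ₑ ^ 2 < ∞ := by
    refine ae_lt_top hm.lintegral_prod_right' ?_
    rw [e2]
    exact ENNReal.mul_ne_top ENNReal.ofReal_ne_top ENNReal.ofReal_ne_top
  refine lintegral_congr_ae ?_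
  filter_upwards [hfin] with x hx
  have hgx : MemLp (fun t => conj (g (t - x))) 2 volume :=
    ((Lp.memLp g).comp_measurePreserving (measurePreserving_sub_right volume x)).star
  have h1 : Integrable fun t => f t * conj (g (t - x)) := (Lp.memLp f).integrable_mul hgx
  have h2 : MemLp (fun t => f t * conj (g (t - x))) 2 volume := by
    refine ⟨h1.aestronglyMeasurable, ?_⟩
    rw [eLpNorm_lt_top_iff_lintegral_rpow_enorm_lt_top two_ne_zero ENNReal.ofNat_ne_top]
    simpa using hx
  rw [← lintegral_enorm_fourier_sq h1 h2]
  congr 1 with ξ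
  congr 2
  rw [stft, Real.fourier_eq]
  congr 1 with t
  rw [Circle.smul_def, Real.fourierChar_apply, smul_eq_mul, mul_comm, real_inner_comm]
  congr 2
  change -(2 * (Real.pi : ℂ) * Complex.I * (inner ℝ t ξ : ℝ)) = _
  push_cast
  ring

end Moyal

/-! ### The localization operator as an integral of rank-one operators. -/

section LocalizationOperator

variable {d : ℕ}

local notation "𝔼" => EuclideanSpace ℝ (Fin d)

theorem integrable_rankOne_tfShift (g : L2Space d) {Ω : Set (PhaseSpace d)} (hΩ : IsCompact Ω) :
    Integrable (fun z => InnerProductSpace.rankOne ℂ (tfShift g z) (tfShift g z))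
      (volume.restrict Ω) := by
  refine ContinuousOn.integrableOn_compact hΩ (Continuous.continuousOn ?_)
  have h := continuous_tfShift g
  exact ((ContinuousLinearMap.smulRightL ℂ (L2Space d) (L2Space d)).continuous.comp
    ((innerSL ℂ).continuous.comp h)).clm_apply h

/-- This licenses Fubini. As `g` is only in `L²`, integrability in `t` is obtained on sets of finite
measure, from `a ≤ 1 + a²`. -/
theorem integrable_locOp_kernel (g f : L2Space d) {Ω : Set (PhaseSpace d)} (hΩ : IsCompact Ω)
    {s : Set 𝔼} (hs : volume s < ∞) :
    Integrable (fun p : PhaseSpace d × 𝔼 => stft g f p.1 * g (p.2 - p.1.fst) *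
      Complex.exp (2 * Real.pi * Complex.I * (inner ℝ p.1.snd p.2 : ℝ)))
      ((volume.restrict Ω).prod (volume.restrict s)) := by
  have hgm : Measurable g := (Lp.stronglyMeasurable g).measurable
  have hf : Continuous fun z : PhaseSpace d => z.fst :=
    continuous_fst.comp (WithLp.prod_continuous_ofLp 2 _ _)
  have hsn : Continuous fun z : PhaseSpace d => z.snd :=
    continuous_snd.comp (WithLp.prod_continuous_ofLp 2 _ _)
  have hst := (continuous_stft g f).measurable
  have hg1 : Measurable fun p : PhaseSpace d × 𝔼 => g (p.2 - p.1.fst) :=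
    hgm.comp (measurable_snd.sub (hf.measurable.comp measurable_fst))
  have hex : Continuous fun p : PhaseSpace d × 𝔼 =>
      Complex.exp (2 * Real.pi * Complex.I * (inner ℝ p.1.snd p.2 : ℝ)) :=
    continuous_exp_inner.comp ((hsn.comp continuous_fst).prodMk continuous_snd)
  refine ⟨(((hst.comp measurable_fst).mul hg1).mul hex.measurable).aestronglyMeasurable, ?_⟩
  have hΩ' : volume Ω < ∞ := hΩ.measure_lt_top
  have : IsFiniteMeasure (volume.restrict Ω) := ⟨by simpa using hΩ'⟩
  have : IsFiniteMeasure (volume.restrict s) := ⟨by simpa using hs⟩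
  let C : ℝ≥0∞ := ENNReal.ofReal (‖g‖ * ‖f‖)
  have hb : ∀ p : PhaseSpace d × 𝔼, ‖stft g f p.1 * g (p.2 - p.1.fst) *
      Complex.exp (2 * Real.pi * Complex.I * (inner ℝ p.1.snd p.2 : ℝ))‖ₑ ≤
      C * (1 + ‖g (p.2 - p.1.fst)‖ₑ ^ 2) := fun p => by
    rw [enorm_mul, enorm_mul]
    have h1 : ‖Complex.exp (2 * Real.pi * Complex.I * (inner ℝ p.1.snd p.2 : ℝ))‖ₑ = 1 := by
      rw [← ofReal_norm, norm_exp_two_pi_I, ENNReal.ofReal_one]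
    rw [h1, mul_one]
    refine mul_le_mul' ?_ ?_
    · rw [← ofReal_norm]
      exact ENNReal.ofReal_le_ofReal (norm_stft_le g f p.1)
    · rcases le_total ‖g (p.2 - p.1.fst)‖ₑ 1 with h | h
      · exact h.trans le_self_add
      · exact (le_self_pow₀ h two_ne_zero).trans le_add_self
  refine (lintegral_mono hb).trans_lt ?_
  have hm : Measurable fun p : PhaseSpace d × 𝔼 => C * (1 + ‖g (p.2 - p.1.fst)‖ₑ ^ 2) := by
    fun_prop
  rw [lintegral_prod _ hm.aemeasurable]
  have hin : ∀ z : PhaseSpace d, ∫⁻ t in s, C * (1 + ‖g (t - z.fst)‖ₑ ^ 2) ≤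
      C * (volume s + ENNReal.ofReal (‖g‖ ^ 2)) := fun z => by
    have hgz : Measurable fun t : 𝔼 => g (t - z.fst) := hgm.comp (measurable_id.sub_const _)
    rw [lintegral_const_mul _ (by fun_prop), lintegral_add_left measurable_const]
    gcongr
    · simp
    · refine (setLIntegral_le_lintegral _ _).trans ?_
      rw [lintegral_sub_right_eq_self (fun t => ‖g t‖ₑ ^ 2), lintegral_enorm_sq_L2]
  refine (lintegral_mono hin).trans_lt ?_
  rw [lintegral_const, Measure.restrict_apply_univ]
  refine ENNReal.mul_lt_top (ENNReal.mul_lt_top ENNReal.ofReal_lt_top ?_) hΩ'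
  exact ENNReal.add_lt_top.2 ⟨hs, ENNReal.ofReal_lt_top⟩

/-- The pointwise formula for the localization operator represents `frameOp`. -/
theorem frameOp_tfShift_ae_eq (g f : L2Space d) {Ω : Set (PhaseSpace d)} (hΩ : IsCompact Ω) :
    (frameOp (tfShift g) (volume.restrict Ω) f : L2Space d) =ᵐ[volume] locOp g Ω f := by
  have hΩ' : IsFiniteMeasure (volume.restrict Ω) := ⟨by simpa using hΩ.measure_lt_top⟩
  refine ae_eq_of_forall_setIntegral_eq_of_sigmaFinite (fun s _ hs => ?_) (fun s _ hs => ?_)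
    (fun s hsm hs => ?_)
  · have : IsFiniteMeasure (volume.restrict s) := ⟨by simpa using hs⟩
    exact ((Lp.memLp _).restrict s).integrable one_le_two
  · have : IsFiniteMeasure (volume.restrict s) := ⟨by simpa using hs⟩
    exact (integrable_locOp_kernel g f hΩ hs).integral_prod_right
  · have : IsFiniteMeasure (volume.restrict s) := ⟨by simpa using hs⟩
    have e1 : ∫ t in s, locOp g Ω f t = ∫ z in Ω, ∫ t in s, stft g f z * g (t - z.fst) *
        Complex.exp (2 * Real.pi * Complex.I * (inner ℝ z.snd t : ℝ)) :=
      (integral_integral_swap (integrable_locOp_kernel g f hΩ hs)).symm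
    -- The integral over `s` is a pairing with the indicator of `s`, so the weak formula for
    -- `frameOp` applies.
    rw [e1, ← L2.inner_indicatorConstLp_one hsm hs.ne,
      inner_frameOp (integrable_rankOne_tfShift g hΩ)]
    congr 1 with z
    rw [L2.inner_indicatorConstLp_one, ← stft_eq_inner, ← integral_const_mul]
    refine integral_congr_ae (ae_restrict_of_ae ?_)
    filter_upwards [coeFn_tfShift g z] with t ht
    rw [ht]
    ring

theorem locOpEigen_iff (g f : L2Space d) {Ω : Set (PhaseSpace d)} (hΩ : IsCompact Ω) (μ : ℂ) :
    LocOpEigen g Ω μ f ↔ frameOp (tfShift g) (volume.restrict Ω) f = μ • f := by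
  constructor
  · intro h
    refine Lp.ext ?_
    filter_upwards [h, frameOp_tfShift_ae_eq g f hΩ, Lp.coeFn_smul μ f] with t h1 h2 h3
    rw [h2, h1, h3, Pi.smul_apply, smul_eq_mul]
  · intro h
    have h0 := frameOp_tfShift_ae_eq g f hΩ
    rw [h] at h0
    filter_upwards [h0, Lp.coeFn_smul μ f] with t h2 h3
    rw [← h2, h3, Pi.smul_apply, smul_eq_mul]

theorem isEigensystem_iff (g : L2Space d) {Ω : Set (PhaseSpace d)} (hΩ : IsCompact Ω) (N : ℕ∞)
    (lam : ℕ → ℝ) (h : ℕ → L2Space d) : IsEigensystem g Ω N lam h ↔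
      IsSpectralSystem (frameOp (tfShift g) (volume.restrict Ω)) N lam h := by
  constructor
  · intro H
    exact ⟨H.orthonormal, fun k hk => (locOpEigen_iff g _ hΩ _).1 (H.eigen k hk), H.ne_zero,
      H.ordered, fun μ f hμ hf => H.complete μ f hμ ((locOpEigen_iff g _ hΩ _).2 hf)⟩
  · intro H
    exact ⟨H.orthonormal, fun k hk => (locOpEigen_iff g _ hΩ _).2 (H.eigen k hk), H.ne_zero,
      H.ordered, fun μ f hμ hf => H.complete μ f hμ ((locOpEigen_iff g _ hΩ _).1 hf)⟩

end LocalizationOperator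

/-! ### Leakage out of a set of finite perimeter. -/

section Perimeter

variable {F : Type*} [NormedAddCommGroup F] [InnerProductSpace ℝ F]
    [FiniteDimensional ℝ F] [MeasurableSpace F] [BorelSpace F]

/-- If `z` lies in `Ω` and `u + z` does not, then `1_Ω` and its translate differ by 1 at `z`. The
`L¹` bound for translates applies. -/
theorem setLIntegral_indicator_compl_translate_le {Ω : Set F} (hΩ : IsCompact Ω)
    (hP : HasFinitePerimeter Ω) (u : F) :
    ∫⁻ z in Ω, Ωᶜ.indicator 1 (u + z) ≤ ENNReal.ofReal ‖u‖ * perimeter Ω := by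
  let f : F → ℝ := Ω.indicator fun _ => 1
  have hfi : Integrable f := hP.1
  have hv : variation f ≠ ∞ := hP.2.ne
  have hfc : HasCompactSupport f :=
    HasCompactSupport.intro hΩ fun x hx => Set.indicator_of_notMem hx _
  have h := integral_abs_translate_sub_le hfi hfc hv u
  have hint : Integrable fun x => |f (x + u) - f x| := ((hfi.comp_add_right u).sub hfi).abs
  calc ∫⁻ z in Ω, Ωᶜ.indicator 1 (u + z)
      ≤ ∫⁻ z in Ω, ENNReal.ofReal |f (z + u) - f z| := by
        refine setLIntegral_mono' hΩ.measurableSet fun z hz => ?_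
        by_cases hu : u + z ∈ Ω
        · rw [Set.indicator_of_notMem (by simpa using hu)]
          exact zero_le
        · have h1 : f (z + u) = 0 := Set.indicator_of_notMem (by rwa [add_comm]) _
          have h2 : f z = 1 := Set.indicator_of_mem hz _
          rw [h1, h2, Set.indicator_of_mem (by simpa using hu)]
          simp
    _ ≤ ∫⁻ z, ENNReal.ofReal |f (z + u) - f z| := setLIntegral_le_lintegral _ _
    _ = ENNReal.ofReal (∫ z, |f (z + u) - f z|) :=
        (ofReal_integral_eq_lintegral_ofReal hint (Eventually.of_forall fun _ => abs_nonneg _)).symm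
    _ ≤ ENNReal.ofReal (‖u‖ * (variation f).toReal) := ENNReal.ofReal_le_ofReal h
    _ = ENNReal.ofReal ‖u‖ * perimeter Ω := by
        rw [ENNReal.ofReal_mul (norm_nonneg _), ENNReal.ofReal_toReal hv]
        rfl

/-- The mass that convolution with `Φ` transports out of `Ω` is controlled by the perimeter. -/
theorem lintegral_lintegral_compl_le {Ω : Set F} (hΩ : IsCompact Ω) (hP : HasFinitePerimeter Ω)
    {Φ : F → ℝ≥0∞} (hΦ : Measurable Φ) :
    ∫⁻ z in Ω, ∫⁻ w in Ωᶜ, Φ (w - z) ≤ (∫⁻ u, ENNReal.ofReal ‖u‖ * Φ u) * perimeter Ω := by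
  have hm : MeasurableSet Ω := hΩ.measurableSet
  have hi : Measurable (Ωᶜ.indicator (1 : F → ℝ≥0∞)) := measurable_one.indicator hm.compl
  have e1 : ∀ z : F, ∫⁻ w in Ωᶜ, Φ (w - z) = ∫⁻ u, Φ u * Ωᶜ.indicator 1 (u + z) := fun z => by
    rw [← lintegral_sub_right_eq_self (fun u => Φ u * Ωᶜ.indicator 1 (u + z)) z,
      ← lintegral_indicator hm.compl]
    congr 1 with w
    by_cases hw : w ∈ Ωᶜ <;> simp [hw, Set.indicator]
  have hm2 : Measurable fun p : F × F => Φ p.2 * Ωᶜ.indicator 1 (p.2 + p.1) :=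
    (hΦ.comp measurable_snd).mul (hi.comp (measurable_snd.add measurable_fst))
  simp only [e1]
  -- After substituting `u = w - z`, integrating first in `z` leaves one translate of `Ω` for each
  -- displacement `u`.
  rw [lintegral_lintegral_swap hm2.aemeasurable, ← lintegral_mul_const _ (by fun_prop)]
  refine lintegral_mono fun u => ?_
  have hiu : Measurable fun z => Ωᶜ.indicator (1 : F → ℝ≥0∞) (u + z) :=
    hi.comp (measurable_const_add u)
  rw [lintegral_const_mul _ hiu]
  calc Φ u * ∫⁻ z in Ω, Ωᶜ.indicator 1 (u + z)
      ≤ Φ u * (ENNReal.ofReal ‖u‖ * perimeter Ω) := by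
        gcongr
        exact setLIntegral_indicator_compl_translate_le hΩ hP u
    _ = ENNReal.ofReal ‖u‖ * Φ u * perimeter Ω := by ring

end Perimeter

/-! ### The kernel `K` and existence of eigensystems. -/

section Spectrograms

variable {d : ℕ}

/-- The reproducing kernel `|⟨π(w)g, π(z)g⟩|²`. -/
noncomputable def gaborKernel (g : L2Space d) (w z : PhaseSpace d) : ℝ≥0∞ :=
  ‖inner ℂ (tfShift g w) (tfShift g z)‖ₑ ^ 2

theorem gaborKernel_comm (g : L2Space d) (w z : PhaseSpace d) :
    gaborKernel g w z = gaborKernel g z w := by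
  rw [gaborKernel, gaborKernel, ← ofReal_norm, ← ofReal_norm, norm_inner_symm]

theorem measurable_gaborKernel (g : L2Space d) :
    Measurable fun p : PhaseSpace d × PhaseSpace d => gaborKernel g p.1 p.2 := by
  have h := continuous_tfShift g
  have : Continuous fun p : PhaseSpace d × PhaseSpace d =>
      inner ℂ (tfShift g p.1) (tfShift g p.2) :=
    (h.comp continuous_fst).inner (h.comp continuous_snd)
  exact this.measurable.enorm.pow_const 2

theorem lintegral_gaborKernel {g : L2Space d} (hg : ‖g‖ = 1) (z : PhaseSpace d) :
    ∫⁻ w, gaborKernel g w z = 1 := by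
  have := lintegral_enorm_stft_sq g (tfShift g z)
  simp only [stft_eq_inner, norm_tfShift, hg] at this
  simpa [gaborKernel] using this

theorem lintegral_gaborKernel_compl_le (g : L2Space d) {Ω : Set (PhaseSpace d)}
    (hΩ : IsCompact Ω) (hP : HasFinitePerimeter Ω) :
    ∫⁻ z in Ω, ∫⁻ w in Ωᶜ, gaborKernel g w z ≤ mStarNormSq g * perimeter Ω := by
  have h := lintegral_lintegral_compl_le hΩ hP
    (Φ := fun u => ‖stft g g u‖ₑ ^ 2) ((continuous_stft g g).measurable.enorm.pow_const 2)
  have e1 : ∀ w z, gaborKernel g w z = ‖stft g g (w - z)‖ₑ ^ 2 := fun w z => by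
    rw [gaborKernel, ← ofReal_norm, norm_inner_tfShift, ofReal_norm]
  simp only [e1]
  refine h.trans_eq ?_
  congr 2 with u
  rw [ENNReal.ofReal_mul (norm_nonneg _), spectrogram, ENNReal.ofReal_pow (norm_nonneg _),
    ofReal_norm (stft g g u)]

theorem lintegral_compl_gaborKernel_eq (g : L2Space d) (Ω : Set (PhaseSpace d)) :
    ∫⁻ z in Ωᶜ, ∫⁻ w in Ω, gaborKernel g w z = ∫⁻ z in Ω, ∫⁻ w in Ωᶜ, gaborKernel g w z := by
  rw [lintegral_lintegral_swap]
  · simp only [gaborKernel_comm g]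
  · exact ((measurable_gaborKernel g).comp measurable_swap).aemeasurable

theorem ofReal_inner_frameOp_self (g f : L2Space d) {Ω : Set (PhaseSpace d)} (hΩ : IsCompact Ω) :
    ENNReal.ofReal (inner ℂ f (frameOp (tfShift g) (volume.restrict Ω) f)).re =
      ∫⁻ z in Ω, ‖inner ℂ (tfShift g z) f‖ₑ ^ 2 := by
  rw [inner_frameOp_self (integrable_rankOne_tfShift g hΩ), Complex.ofReal_re,
    ofReal_integral_eq_lintegral_ofReal]
  · simp only [ENNReal.ofReal_pow (norm_nonneg _), ofReal_norm]
  · refine ContinuousOn.integrableOn_compact hΩ (Continuous.continuousOn ?_)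
    exact (((continuous_tfShift g).inner continuous_const).norm).pow 2
  · exact Eventually.of_forall fun z => by positivity

theorem inner_frameOp_tfShift_nonneg (g f : L2Space d) {Ω : Set (PhaseSpace d)}
    (hΩ : IsCompact Ω) :
    0 ≤ (inner ℂ f (frameOp (tfShift g) (volume.restrict Ω) f)).re := by
  rw [inner_frameOp_self (integrable_rankOne_tfShift g hΩ), Complex.ofReal_re]
  exact integral_nonneg fun z => by positivity

/-- The trace bound is `|Ω|`: Bessel's inequality for the unit vector `π(z)g`, integrated over `Ω`.
-/
theorem exists_isEigensystem {g : L2Space d} (hg : ‖g‖ = 1) {Ω : Set (PhaseSpace d)}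
    (hΩ : IsCompact Ω) :
    ∃ (N : ℕ∞) (lam : ℕ → ℝ) (h : ℕ → L2Space d), IsEigensystem g Ω N lam h := by
  simp only [isEigensystem_iff g hΩ]
  have hi := integrable_rankOne_tfShift g hΩ
  refine exists_isSpectralSystem (isSymmetric_frameOp hi)
    (fun f => inner_frameOp_tfShift_nonneg g f hΩ) (B := (volume Ω).toReal) fun e n he => ?_
  rw [← ENNReal.ofReal_le_iff_le_toReal hΩ.measure_lt_top.ne,
    ENNReal.ofReal_sum_of_nonneg fun i _ => inner_frameOp_tfShift_nonneg g _ hΩ]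
  simp only [ofReal_inner_frameOp_self g _ hΩ]
  rw [← lintegral_finsetSum _ fun i _ =>
    (((continuous_tfShift g).inner continuous_const).measurable.enorm.pow_const 2)]
  calc ∫⁻ z in Ω, ∑ i ∈ Finset.range n, ‖inner ℂ (tfShift g z) (e i)‖ₑ ^ 2
      ≤ ∫⁻ z in Ω, 1 := by
        refine lintegral_mono fun z => ?_
        have hb := he.sum_inner_products_le (s := Finset.univ) (tfShift g z)
        rw [norm_tfShift, hg, one_pow, Fin.sum_univ_eq_sum_range
          (fun i => ‖inner ℂ (e i) (tfShift g z)‖ ^ 2)] at hb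
        have e2 : ∀ i, ‖inner ℂ (tfShift g z) (e i)‖ₑ ^ 2 =
            ENNReal.ofReal (‖inner ℂ (e i) (tfShift g z)‖ ^ 2) := fun i => by
          rw [ENNReal.ofReal_pow (norm_nonneg _), norm_inner_symm, ofReal_norm]
        simp only [e2]
        rw [← ENNReal.ofReal_sum_of_nonneg fun i _ => by positivity]
        simpa using ENNReal.ofReal_le_ofReal hb
    _ = volume Ω := by simp

/-! ### Eigenvalue identities: trace, defect and counting. -/

/-- The eigenvalue sequence, continued by zero. -/
noncomputable def extendedEigenvalue (N : ℕ∞) (lam : ℕ → ℝ) (k : ℕ) : ℝ :=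
  open Classical in if (k : ℕ∞) < N then lam k else 0

variable {g : L2Space d} {Ω : Set (PhaseSpace d)} {N : ℕ∞} {lam : ℕ → ℝ} {h : ℕ → L2Space d}

theorem extendedEigenvalue_of_lt {k : ℕ} (hk : (k : ℕ∞) < N) :
    extendedEigenvalue N lam k = lam k := if_pos hk

theorem extendedEigenvalue_of_not_lt {k : ℕ} (hk : ¬ (k : ℕ∞) < N) :
    extendedEigenvalue N lam k = 0 := if_neg hk

theorem IsSpectralSystem.norm_eq_one
    (hS : IsSpectralSystem (frameOp (tfShift g) (volume.restrict Ω)) N lam h) {k : ℕ}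
    (hk : (k : ℕ∞) < N) : ‖h k‖ = 1 := hS.orthonormal.1 ⟨k, hk⟩

theorem IsSpectralSystem.lintegral_eq_one (hg : ‖g‖ = 1)
    (hS : IsSpectralSystem (frameOp (tfShift g) (volume.restrict Ω)) N lam h) {k : ℕ}
    (hk : (k : ℕ∞) < N) : ∫⁻ z, ‖stft g (h k) z‖ₑ ^ 2 = 1 := by
  rw [lintegral_enorm_stft_sq, hg, hS.norm_eq_one hk]
  simp

theorem IsSpectralSystem.inner_re_eq
    (hS : IsSpectralSystem (frameOp (tfShift g) (volume.restrict Ω)) N lam h) {k : ℕ}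
    (hk : (k : ℕ∞) < N) :
    (inner ℂ (h k) (frameOp (tfShift g) (volume.restrict Ω) (h k))).re = lam k := by
  rw [inner_map_self_of_eigen (hS.eigen k hk), hS.norm_eq_one hk]
  simp

theorem IsSpectralSystem.ofReal_eq_setLIntegral (hΩ : IsCompact Ω)
    (hS : IsSpectralSystem (frameOp (tfShift g) (volume.restrict Ω)) N lam h) {k : ℕ}
    (hk : (k : ℕ∞) < N) : ENNReal.ofReal (lam k) = ∫⁻ z in Ω, ‖stft g (h k) z‖ₑ ^ 2 := by
  rw [← hS.inner_re_eq hk, ofReal_inner_frameOp_self g _ hΩ]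
  simp only [stft_eq_inner]

theorem IsSpectralSystem.nonneg (hΩ : IsCompact Ω)
    (hS : IsSpectralSystem (frameOp (tfShift g) (volume.restrict Ω)) N lam h) {k : ℕ}
    (hk : (k : ℕ∞) < N) : 0 ≤ lam k := by
  rw [← hS.inner_re_eq hk]
  exact inner_frameOp_tfShift_nonneg g _ hΩ

theorem IsSpectralSystem.le_one (hg : ‖g‖ = 1) (hΩ : IsCompact Ω)
    (hS : IsSpectralSystem (frameOp (tfShift g) (volume.restrict Ω)) N lam h) {k : ℕ}
    (hk : (k : ℕ∞) < N) : lam k ≤ 1 := by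
  rw [← ENNReal.ofReal_le_one, hS.ofReal_eq_setLIntegral hΩ hk, ← hS.lintegral_eq_one hg hk]
  exact setLIntegral_le_lintegral _ _

theorem IsSpectralSystem.extended_nonneg (hΩ : IsCompact Ω)
    (hS : IsSpectralSystem (frameOp (tfShift g) (volume.restrict Ω)) N lam h) (k : ℕ) :
    0 ≤ extendedEigenvalue N lam k := by
  by_cases hk : (k : ℕ∞) < N
  · rw [extendedEigenvalue_of_lt hk]; exact hS.nonneg hΩ hk
  · rw [extendedEigenvalue_of_not_lt hk]

theorem IsSpectralSystem.extended_le_one (hg : ‖g‖ = 1) (hΩ : IsCompact Ω)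
    (hS : IsSpectralSystem (frameOp (tfShift g) (volume.restrict Ω)) N lam h) (k : ℕ) :
    extendedEigenvalue N lam k ≤ 1 := by
  by_cases hk : (k : ℕ∞) < N
  · rw [extendedEigenvalue_of_lt hk]; exact hS.le_one hg hΩ hk
  · rw [extendedEigenvalue_of_not_lt hk]; exact zero_le_one

theorem IsSpectralSystem.extended_antitone (hΩ : IsCompact Ω)
    (hS : IsSpectralSystem (frameOp (tfShift g) (volume.restrict Ω)) N lam h) :
    Antitone (extendedEigenvalue N lam) := fun j k hjk => by
  by_cases hk : (k : ℕ∞) < N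
  · have hj : (j : ℕ∞) < N := lt_of_le_of_lt (by exact_mod_cast hjk) hk
    rw [extendedEigenvalue_of_lt hk, extendedEigenvalue_of_lt hj]
    exact hS.ordered j k hjk hk
  · rw [extendedEigenvalue_of_not_lt hk]
    exact hS.extended_nonneg hΩ j

theorem measurable_enorm_stft_sq (g f : L2Space d) : Measurable fun z => ‖stft g f z‖ₑ ^ 2 :=
  (continuous_stft g f).measurable.enorm.pow_const 2

/-- Both sides are `⟨π(z)g, H_Ω π(z)g⟩`, one by the spectral expansion and one by the definition of
the operator. Continuation by zero removes the indices `k ≥ N`, where `h k` is arbitrary. -/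
theorem IsSpectralSystem.tsum_mul_enorm_stft_sq (hΩ : IsCompact Ω)
    (hS : IsSpectralSystem (frameOp (tfShift g) (volume.restrict Ω)) N lam h) (z : PhaseSpace d) :
    ∑' k, ENNReal.ofReal (extendedEigenvalue N lam k) * ‖stft g (h k) z‖ₑ ^ 2 =
      ∫⁻ w in Ω, gaborKernel g w z := by
  have hi := integrable_rankOne_tfShift g hΩ
  have : IsFiniteMeasure (volume.restrict Ω) := ⟨by simpa using hΩ.measure_lt_top⟩
  have h1 := hS.hasSum (isSymmetric_frameOp hi) (isCompactOperator_frameOp hi) (tfShift g z)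
  have h2 := congrArg ENNReal.ofReal h1.tsum_eq
  rw [ofReal_inner_frameOp_self g _ hΩ, ENNReal.ofReal_tsum_of_nonneg
    (fun k => mul_nonneg (hS.nonneg hΩ k.2) (by positivity)) h1.summable] at h2
  change _ = ∫⁻ w in Ω, ‖inner ℂ (tfShift g w) (tfShift g z)‖ₑ ^ 2
  rw [← h2]
  refine Eq.trans ?_ (tsum_subtype {k : ℕ | (k : ℕ∞) < N}
    (fun k => ENNReal.ofReal (lam k * ‖inner ℂ (h k) (tfShift g z)‖ ^ 2))).symm
  congr 1 with k
  by_cases hk : (k : ℕ∞) < N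
  · rw [extendedEigenvalue_of_lt hk, Set.indicator_of_mem (by exact hk),
      ENNReal.ofReal_mul (hS.nonneg hΩ hk), ENNReal.ofReal_pow (norm_nonneg _), stft_eq_inner,
      norm_inner_symm, ofReal_norm]
  · rw [extendedEigenvalue_of_not_lt hk, Set.indicator_of_notMem (by exact hk)]
    simp

theorem IsSpectralSystem.mul_lintegral (hg : ‖g‖ = 1)
    (hS : IsSpectralSystem (frameOp (tfShift g) (volume.restrict Ω)) N lam h) (k : ℕ) :
    ENNReal.ofReal (extendedEigenvalue N lam k) * ∫⁻ z, ‖stft g (h k) z‖ₑ ^ 2 =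
      ENNReal.ofReal (extendedEigenvalue N lam k) := by
  by_cases hk : (k : ℕ∞) < N
  · rw [hS.lintegral_eq_one hg hk, mul_one]
  · rw [extendedEigenvalue_of_not_lt hk, ENNReal.ofReal_zero, zero_mul]

/-- Integrate the pointwise identity over all of phase space: the spectrograms with nonzero weight
and the kernel all have mass 1. -/
theorem IsSpectralSystem.tsum_eq_volume (hg : ‖g‖ = 1) (hΩ : IsCompact Ω)
    (hS : IsSpectralSystem (frameOp (tfShift g) (volume.restrict Ω)) N lam h) :
    ∑' k, ENNReal.ofReal (extendedEigenvalue N lam k) = volume Ω := by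
  have h1 : ∫⁻ z, ∫⁻ w in Ω, gaborKernel g w z = volume Ω := by
    rw [lintegral_lintegral_swap]
    · have : ∀ w, ∫⁻ z, gaborKernel g w z = 1 := fun w => by
        rw [← lintegral_gaborKernel hg w]
        simp only [gaborKernel_comm g w]
      simp [this]
    · exact ((measurable_gaborKernel g).comp measurable_swap).aemeasurable
  rw [← h1]
  simp only [← hS.tsum_mul_enorm_stft_sq hΩ]
  rw [lintegral_tsum fun k => ((measurable_enorm_stft_sq g (h k)).const_mul _).aemeasurable]
  congr 1 with k
  rw [lintegral_const_mul _ (measurable_enorm_stft_sq g (h k)), hS.mul_lintegral hg]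

/-- Integrate the pointwise identity over `Ωᶜ` only: the `k`-th spectrogram has mass `λ_k` in `Ω`,
hence `1 - λ_k` outside. -/
theorem IsSpectralSystem.tsum_mul_one_sub (hg : ‖g‖ = 1) (hΩ : IsCompact Ω)
    (hS : IsSpectralSystem (frameOp (tfShift g) (volume.restrict Ω)) N lam h) :
    ∑' k, ENNReal.ofReal (extendedEigenvalue N lam k * (1 - extendedEigenvalue N lam k)) =
      ∫⁻ z in Ωᶜ, ∫⁻ w in Ω, gaborKernel g w z := by
  simp only [← hS.tsum_mul_enorm_stft_sq hΩ]
  rw [lintegral_tsum fun k => ((measurable_enorm_stft_sq g (h k)).const_mul _).aemeasurable]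
  congr 1 with k
  rw [lintegral_const_mul _ (measurable_enorm_stft_sq g (h k)),
    ENNReal.ofReal_mul (hS.extended_nonneg hΩ k)]
  by_cases hk : (k : ℕ∞) < N
  · congr 1
    rw [extendedEigenvalue_of_lt hk, ENNReal.ofReal_sub _ (hS.nonneg hΩ hk), ENNReal.ofReal_one,
      ← hS.lintegral_eq_one hg hk,
      ← lintegral_add_compl (fun z => ‖stft g (h k) z‖ₑ ^ 2) hΩ.measurableSet,
      ← hS.ofReal_eq_setLIntegral hΩ hk, ENNReal.add_sub_cancel_left ENNReal.ofReal_ne_top]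
  · rw [extendedEigenvalue_of_not_lt hk, ENNReal.ofReal_zero, zero_mul, zero_mul]

theorem IsSpectralSystem.hasSum_extended (hg : ‖g‖ = 1) (hΩ : IsCompact Ω)
    (hS : IsSpectralSystem (frameOp (tfShift g) (volume.restrict Ω)) N lam h) :
    HasSum (extendedEigenvalue N lam) (volume Ω).toReal := by
  have h1 := hS.tsum_eq_volume hg hΩ
  have h2 := ENNReal.hasSum_toReal (h1.trans_ne hΩ.measure_lt_top.ne)
  rw [← ENNReal.tsum_toReal_eq fun _ => ENNReal.ofReal_ne_top, h1] at h2
  simpa only [ENNReal.toReal_ofReal (hS.extended_nonneg hΩ _)] using h2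

/-- The eigenvalues are at most 1 and sum to `|Ω|`, so there are at least `|Ω|` of them. -/
theorem IsSpectralSystem.ceilVolume_le (hg : ‖g‖ = 1) (hΩ : IsCompact Ω)
    (hS : IsSpectralSystem (frameOp (tfShift g) (volume.restrict Ω)) N lam h) :
    (ceilVolume Ω : ℕ∞) ≤ N := by
  induction N using ENat.recTopCoe with
  | top => exact le_top
  | coe n =>
    have h1 := hS.hasSum_extended hg hΩ
    have h2 := h1.unique (hasSum_sum_of_ne_finset_zero (s := Finset.range n) fun k hk => by
      refine extendedEigenvalue_of_not_lt ?_
      simpa using hk)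
    have h3 : (volume Ω).toReal ≤ n := by
      rw [h2]
      simpa using Finset.sum_le_sum (s := Finset.range n)
        fun k _ => hS.extended_le_one hg hΩ k
    exact_mod_cast Nat.ceil_le.2 h3

/-- The bulk defect plus the tail of the eigenvalues is controlled by the perimeter. -/
theorem IsSpectralSystem.sum_defect_add_tail_le (hg : ‖g‖ = 1) (hM : MemMStar g)
    (hΩ : IsCompact Ω) (hP : HasFinitePerimeter Ω)
    (hS : IsSpectralSystem (frameOp (tfShift g) (volume.restrict Ω)) N lam h) :
    ∑ k ∈ Finset.range (ceilVolume Ω), ENNReal.ofReal (1 - extendedEigenvalue N lam k) +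
      ∑' k, ENNReal.ofReal (extendedEigenvalue N lam (k + ceilVolume Ω)) ≤
      1 + 2 * (mStarNormSq g * perimeter Ω) := by
  have hl0 := hS.extended_nonneg hΩ
  have hl1 := hS.extended_le_one hg hΩ
  have hV := hS.hasSum_extended hg hΩ
  have hle : ∑' k, ENNReal.ofReal
      (extendedEigenvalue N lam k * (1 - extendedEigenvalue N lam k)) ≤
      mStarNormSq g * perimeter Ω := by
    rw [hS.tsum_mul_one_sub hg hΩ, lintegral_compl_gaborKernel_eq]
    exact lintegral_gaborKernel_compl_le g hΩ hP
  have hfin : mStarNormSq g * perimeter Ω ≠ ∞ := ENNReal.mul_ne_top hM.ne hP.2.ne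
  have hτ := ENNReal.hasSum_toReal (ne_top_of_le_ne_top hfin hle)
  rw [← ENNReal.tsum_toReal_eq fun _ => ENNReal.ofReal_ne_top] at hτ
  simp only [ENNReal.toReal_ofReal (mul_nonneg (hl0 _) (sub_nonneg.2 (hl1 _)))] at hτ
  have key := sum_one_sub_add_tail_le (hS.extended_antitone hΩ) hl1 hV hτ
  have hs : Summable fun k => extendedEigenvalue N lam (k + ceilVolume Ω) :=
    (summable_nat_add_iff _).2 hV.summable
  rw [← ENNReal.ofReal_sum_of_nonneg fun k _ => sub_nonneg.2 (hl1 k),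
    ← ENNReal.ofReal_tsum_of_nonneg (fun k => hl0 _) hs,
    ← ENNReal.ofReal_add (Finset.sum_nonneg fun k _ => sub_nonneg.2 (hl1 k))
      (tsum_nonneg fun k => hl0 _)]
  refine (ENNReal.ofReal_le_ofReal key).trans ?_
  rw [ENNReal.ofReal_add zero_le_one (by positivity), ENNReal.ofReal_one,
    ENNReal.ofReal_mul zero_le_two, ENNReal.ofReal_toReal (ne_top_of_le_ne_top hfin hle),
    ENNReal.ofReal_ofNat]
  gcongr

/-! ### Comparison of the level set with the domain. -/

/-- A function that is at least `1/2` where `Ω` and the level set differ. -/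
noncomputable def recoveryError (g : L2Space d) (Ω : Set (PhaseSpace d)) (l : ℕ → ℝ)
    (h : ℕ → L2Space d) (z : PhaseSpace d) : ℝ≥0∞ :=
  (∑ k ∈ Finset.range (ceilVolume Ω), ENNReal.ofReal (1 - l k) * ‖stft g (h k) z‖ₑ ^ 2 +
    ∑' k, ENNReal.ofReal (l (k + ceilVolume Ω)) * ‖stft g (h (k + ceilVolume Ω)) z‖ₑ ^ 2) +
  (Ω.indicator (fun z => ∫⁻ w in Ωᶜ, gaborKernel g w z) z +
    Ωᶜ.indicator (fun z => ∫⁻ w in Ω, gaborKernel g w z) z)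

theorem ofReal_accumulatedSpectrogram (g : L2Space d) (Ω : Set (PhaseSpace d))
    (h : ℕ → L2Space d) (z : PhaseSpace d) :
    ENNReal.ofReal (accumulatedSpectrogram g Ω h z) =
      ∑ k ∈ Finset.range (ceilVolume Ω), ‖stft g (h k) z‖ₑ ^ 2 := by
  rw [accumulatedSpectrogram, ENNReal.ofReal_sum_of_nonneg fun k _ => by
    unfold spectrogram; positivity]
  simp only [spectrogram, ENNReal.ofReal_pow (norm_nonneg _), ofReal_norm]

/-- At a point of `Ω` with `ρ ≤ 1/2`, the kernel mass 1 splits into `∑_{k<A} λ_k s_k ≤ ρ`, the tail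
and the mass escaping to `Ωᶜ`, so the last two carry at least 1/2. At a point outside `Ω` with `ρ >
1/2`, write `ρ` as the defect sum plus `∑_{k<A} λ_k s_k`; the latter is at most the kernel mass
coming from `Ω`. -/
theorem IsSpectralSystem.half_le_recoveryError (hg : ‖g‖ = 1) (hΩ : IsCompact Ω)
    (hS : IsSpectralSystem (frameOp (tfShift g) (volume.restrict Ω)) N lam h) {z : PhaseSpace d}
    (hz : z ∈ Ω ∆ recoveredDomain g Ω h) :
    1 / 2 ≤ recoveryError g Ω (extendedEigenvalue N lam) h z := by
  have hl0 := hS.extended_nonneg hΩ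
  have hl1 := hS.extended_le_one hg hΩ
  have hB := hS.tsum_mul_enorm_stft_sq hΩ z
  have hsplit := Summable.sum_add_tsum_nat_add' (k := ceilVolume Ω) (f := fun k =>
    ENNReal.ofReal (extendedEigenvalue N lam k) * ‖stft g (h k) z‖ₑ ^ 2) ENNReal.summable
  replace hB := hsplit.trans hB
  have hR := ofReal_accumulatedSpectrogram g Ω h z
  have hhalf : ENNReal.ofReal (1 / 2) = 1 / 2 := by
    rw [ENNReal.ofReal_div_of_pos two_pos]; simp
  have aux₁ : ∀ s t b x y : ℝ≥0∞, s + t + b = 1 → s ≤ 1 / 2 → 1 / 2 ≤ x + t + (b + y) := by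
    intro s t b x y h1 h2
    have h3 : (1 : ℝ≥0∞) / 2 + 1 / 2 ≤ 1 / 2 + (t + b) :=
      calc (1 : ℝ≥0∞) / 2 + 1 / 2 = s + (t + b) := by rw [ENNReal.add_halves, ← add_assoc, h1]
        _ ≤ 1 / 2 + (t + b) := by gcongr
    refine ((ENNReal.add_le_add_iff_left (by simp)).1 h3).trans ?_
    exact add_le_add le_add_self le_self_add
  have aux₂ : ∀ s t x y : ℝ≥0∞, 1 / 2 ≤ x + s → 1 / 2 ≤ x + t + (y + (s + t)) := by
    intro s t x y h1
    exact h1.trans (add_le_add le_self_add (le_self_add.trans le_add_self))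
  rcases hz with ⟨hzΩ, hzr⟩ | ⟨hzr, hzΩ⟩
  · have hρ : ENNReal.ofReal (accumulatedSpectrogram g Ω h z) ≤ 1 / 2 := by
      rw [← hhalf]
      exact ENNReal.ofReal_le_ofReal (not_lt.1 hzr)
    rw [hR] at hρ
    have h1 : (∫⁻ w in Ω, gaborKernel g w z) + ∫⁻ w in Ωᶜ, gaborKernel g w z = 1 := by
      rw [lintegral_add_compl _ hΩ.measurableSet, lintegral_gaborKernel hg]
    have h2 : ∑ k ∈ Finset.range (ceilVolume Ω),
        ENNReal.ofReal (extendedEigenvalue N lam k) * ‖stft g (h k) z‖ₑ ^ 2 ≤ 1 / 2 :=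
      (Finset.sum_le_sum fun k _ => mul_le_of_le_one_left' (by
        simpa using ENNReal.ofReal_le_ofReal (hl1 k))).trans hρ
    rw [← hB] at h1
    rw [recoveryError, Set.indicator_of_mem hzΩ]
    exact aux₁ _ _ _ _ _ h1 h2
  · have hρ : 1 / 2 ≤ ENNReal.ofReal (accumulatedSpectrogram g Ω h z) := by
      rw [← hhalf]
      exact ENNReal.ofReal_le_ofReal (le_of_lt hzr)
    have h2 : ∑ k ∈ Finset.range (ceilVolume Ω), ‖stft g (h k) z‖ₑ ^ 2 =
        ∑ k ∈ Finset.range (ceilVolume Ω),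
          ENNReal.ofReal (1 - extendedEigenvalue N lam k) * ‖stft g (h k) z‖ₑ ^ 2 +
        ∑ k ∈ Finset.range (ceilVolume Ω),
          ENNReal.ofReal (extendedEigenvalue N lam k) * ‖stft g (h k) z‖ₑ ^ 2 := by
      rw [← Finset.sum_add_distrib]
      refine Finset.sum_congr rfl fun k _ => ?_
      rw [← add_mul, ← ENNReal.ofReal_add (sub_nonneg.2 (hl1 k)) (hl0 k)]
      simp
    rw [hR, h2] at hρ
    rw [recoveryError, Set.indicator_of_mem (s := Ωᶜ) hzΩ, ← hB]
    exact aux₂ _ _ _ _ hρ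

theorem IsSpectralSystem.lintegral_recoveryError_le (hg : ‖g‖ = 1) (hM : MemMStar g)
    (hΩ : IsCompact Ω) (hP : HasFinitePerimeter Ω)
    (hS : IsSpectralSystem (frameOp (tfShift g) (volume.restrict Ω)) N lam h) :
    ∫⁻ z, recoveryError g Ω (extendedEigenvalue N lam) h z ≤
      1 + 4 * (mStarNormSq g * perimeter Ω) := by
  have hm := hΩ.measurableSet
  have hs : ∀ k, Measurable fun z => ‖stft g (h k) z‖ₑ ^ 2 := fun k =>
    measurable_enorm_stft_sq g (h k)
  have hB : ∀ S : Set (PhaseSpace d), Measurable fun z => ∫⁻ w in S, gaborKernel g w z :=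
    fun S => (measurable_gaborKernel g).lintegral_prod_left'
  -- Needed for the defect sum: an index `k ≥ N` would carry weight `1 - 0 = 1` on an arbitrary `h
  -- k`, whose spectrogram need not have mass 1.
  have hN := hS.ceilVolume_le hg hΩ
  have m1 : Measurable fun z => ∑ k ∈ Finset.range (ceilVolume Ω),
      ENNReal.ofReal (1 - extendedEigenvalue N lam k) * ‖stft g (h k) z‖ₑ ^ 2 :=
    Finset.measurable_sum _ fun k _ => (hs k).const_mul _
  have m2 : Measurable fun z => ∑' k, ENNReal.ofReal (extendedEigenvalue N lam
      (k + ceilVolume Ω)) * ‖stft g (h (k + ceilVolume Ω)) z‖ₑ ^ 2 :=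
    Measurable.tsum fun k => (hs _).const_mul _
  have m3 : Measurable fun z => ∑ k ∈ Finset.range (ceilVolume Ω),
      ENNReal.ofReal (1 - extendedEigenvalue N lam k) * ‖stft g (h k) z‖ₑ ^ 2 +
      ∑' k, ENNReal.ofReal (extendedEigenvalue N lam (k + ceilVolume Ω)) *
        ‖stft g (h (k + ceilVolume Ω)) z‖ₑ ^ 2 := m1.add m2
  unfold recoveryError
  rw [lintegral_add_left m3, lintegral_add_left m1,
    lintegral_add_left ((hB _).indicator hm), lintegral_indicator hm, lintegral_indicator hm.compl,
    lintegral_compl_gaborKernel_eq, lintegral_finsetSum _ fun k _ => (hs k).const_mul _,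
    lintegral_tsum fun k => ((hs _).const_mul _).aemeasurable]
  have e1 : ∀ k ∈ Finset.range (ceilVolume Ω),
      ∫⁻ z, ENNReal.ofReal (1 - extendedEigenvalue N lam k) * ‖stft g (h k) z‖ₑ ^ 2 =
        ENNReal.ofReal (1 - extendedEigenvalue N lam k) := fun k hk => by
    have hk' : (k : ℕ∞) < N :=
      lt_of_lt_of_le (by exact_mod_cast Finset.mem_range.1 hk) hN
    rw [lintegral_const_mul _ (hs k), hS.lintegral_eq_one hg hk', mul_one]
  have e2 : ∀ k, ∫⁻ z, ENNReal.ofReal (extendedEigenvalue N lam (k + ceilVolume Ω)) *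
      ‖stft g (h (k + ceilVolume Ω)) z‖ₑ ^ 2 =
        ENNReal.ofReal (extendedEigenvalue N lam (k + ceilVolume Ω)) := fun k => by
    rw [lintegral_const_mul _ (hs _), hS.mul_lintegral hg]
  rw [Finset.sum_congr rfl e1, tsum_congr e2]
  have hleak := lintegral_gaborKernel_compl_le g hΩ hP
  calc _ ≤ (1 + 2 * (mStarNormSq g * perimeter Ω)) +
        (mStarNormSq g * perimeter Ω + mStarNormSq g * perimeter Ω) :=
      add_le_add (hS.sum_defect_add_tail_le hg hM hΩ hP) (add_le_add hleak hleak)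
    _ = 1 + 4 * (mStarNormSq g * perimeter Ω) := by ring

/-- Chebyshev's inequality at height 1/2 gives the bound `2 (1 + 4P)`, and `1 ≤ P` turns it into `10
P`. -/
theorem IsSpectralSystem.volume_symmDiff_le (hg : ‖g‖ = 1) (hM : MemMStar g)
    (hΩ : IsCompact Ω) (hP : HasFinitePerimeter Ω) (h1 : 1 ≤ mStarNormSq g * perimeter Ω)
    (hS : IsSpectralSystem (frameOp (tfShift g) (volume.restrict Ω)) N lam h) :
    volume (Ω ∆ recoveredDomain g Ω h) ≤ 10 * (mStarNormSq g * perimeter Ω) := by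
  have hmeas : MeasurableSet (Ω ∆ recoveredDomain g Ω h) := by
    refine hΩ.measurableSet.symmDiff (measurableSet_lt measurable_const ?_)
    refine Finset.measurable_sum _ fun k _ => ?_
    exact (continuous_stft g (h k)).norm.pow 2 |>.measurable
  have h2 : ∫⁻ z in Ω ∆ recoveredDomain g Ω h, 1 / 2 ≤
      ∫⁻ z, recoveryError g Ω (extendedEigenvalue N lam) h z :=
    (setLIntegral_mono' hmeas fun z hz => hS.half_le_recoveryError hg hΩ hz).trans
      (setLIntegral_le_lintegral _ _)
  rw [setLIntegral_const] at h2
  have h3 := h2.trans (hS.lintegral_recoveryError_le hg hM hΩ hP)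
  have h4 : 2 * (1 / 2 * volume (Ω ∆ recoveredDomain g Ω h)) =
      volume (Ω ∆ recoveredDomain g Ω h) := by
    rw [← mul_assoc, one_div, ENNReal.mul_inv_cancel two_ne_zero ENNReal.ofNat_ne_top, one_mul]
  rw [← h4]
  calc 2 * (1 / 2 * volume (Ω ∆ recoveredDomain g Ω h))
      ≤ 2 * (1 + 4 * (mStarNormSq g * perimeter Ω)) := by gcongr
    _ ≤ 2 * (mStarNormSq g * perimeter Ω + 4 * (mStarNormSq g * perimeter Ω)) := by gcongr
    _ = 10 * (mStarNormSq g * perimeter Ω) := by ring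

end Spectrograms

theorem mainTheorem6 :
    ∃ C : ℝ≥0, ∀ (d : ℕ) (g : L2Space d) (Ω : Set (PhaseSpace d)),
      ‖g‖ = 1 → MemMStar g → IsCompact Ω → HasFinitePerimeter Ω →
      1 ≤ mStarNormSq g * perimeter Ω →
      (∃ (N : ℕ∞) (lam : ℕ → ℝ) (h : ℕ → L2Space d), IsEigensystem g Ω N lam h) ∧
      ∀ (N : ℕ∞) (lam : ℕ → ℝ) (h : ℕ → L2Space d), IsEigensystem g Ω N lam h →
        (ceilVolume Ω : ℕ∞) ≤ N ∧
        volume (Ω ∆ recoveredDomain g Ω h) ≤ C * (mStarNormSq g * perimeter Ω) := by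
  refine ⟨10, fun d g Ω hg hM hΩ hP h1 => ⟨exists_isEigensystem hg hΩ, fun N lam h hS => ?_⟩⟩
  rw [isEigensystem_iff g hΩ] at hS
  exact ⟨hS.ceilVolume_le hg hΩ, by simpa using hS.volume_symmDiff_le hg hM hΩ hP h1⟩
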